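/- Let $Q$ be a quiver with vertex set $[n]=\{1,\dots,n\}$ whose underlying graph is, up to relabelling of the vertices, the Dynkin diagram $A_n$ ($n\ge 1$: a path with $n$ vertices) or $D_n$ ($n\ge 4$: vertex $n$ is joined to $n-1$, $n-2$ and $n-3$, and $1 - 2 - \cdots - (n-3)$ is a path). Let $(a_{ij})$ be its Cartan matrix: $a_{ii}=2$, and for $i\ne j$, $a_{ij}=-1$ if $i$ and $j$ are joined by an arrow and $a_{ij}=0$ otherwise. Let $\alpha_1,\dots,\alpha_n$ be the simple roots, $s_i(\alpha_j)=\alpha_j-a_{ij}\alpha_i$ the simple reflections on $\bigoplus_i\mathbb Z\alpha_i$, $\Delta_Q$ the root system (the orbit of the simple roots under the Weyl group generated by the $s_i$), and $\Delta_Q^+$ the set of positive roots, i.e. of roots with non-negative coefficients. Write $\alpha\le\alpha'$ if each coefficient of $\alpha$ is at most the corresponding coefficient of $\alpha'$. Let $P_Q$ be the set of permutations $\pi$ of $[n]$ such that there is no arrow $\pi(a)\to\pi(b)$ in $Q$ whenever $a>b$. Let $H=\mathbb R\times\mathbb R_{\ge 0}$, $p_i=(i,1)$, $\rho_i=\{(i,y)\mid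 y\ge 1\}$ for $i\in[n]$, $P=\{p_1,\dots,p_n\}$ and $b=(0,0)$. An admissible curve is a $C^\infty$ map $\gamma\colon[0,1]\to H$ with $\gamma(0)\in P$, $\gamma(1)=b$, $\gamma(x)\notin P\cup\{b\}$ for $0<x<1$, which on $(0,1]$ meets the rays $\rho_i$ only transversely; it is non-self-crossing if it is injective. Suppose that $\gamma$ starts at $p_{k_0}$ and on $(0,1]$ meets the rays finitely often, crossing $\rho_{k_1},\dots,\rho_{k_m}$ in this order. Put $\beta_i=s_{\pi(k_i)}\cdots s_{\pi(k_1)}\alpha_{\pi(k_0)}$ for $0\le i\le m$. The curve $\gamma$ is non-decreasing with respect to $\pi$ if $\beta_{i-1}\le\beta_i$ for all $1\le i\le m$, and its associated root $\alpha_\pi(\gamma)$ is $\beta_m$ if $\beta_m$ is positive and $-\beta_m$ if $\beta_m$ is negative. Let $\Gamma_{\pi,nd}$ be the set of non-self-crossing admissible curves that are non-decreasing with respect to $\pi$. Then for every single $\pi\in P_Q$, $$\{\alpha_\pi(\gamma)\mid\gamma\in\Gamma_{\pi,nd}\}=\Delta_Q^+ .$$ -/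

import Mathlib

open scoped ContDiff

universe v

namespace AdmissibleCurve

/-! ### Quivers on `[n]`, their Cartan matrices and root systems -/

/-- The exchange matrix: `b i j` is the number of arrows `i ⟶ j` minus the number of
arrows `j ⟶ i` (at most one of the two is nonzero when there are no oriented 2-cycles). -/
noncomputable def exchangeMatrix {n : ℕ} (Q : Quiver.{v} (Fin n)) :
    Matrix (Fin n) (Fin n) ℤ :=
  fun i j => (Nat.card (Q.Hom i j) : ℤ) - (Nat.card (Q.Hom j i) : ℤ)

/-- The Cartan matrix of the quiver: `2` on the diagonal, `-|b i j|` off the diagonal. -/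
noncomputable def cartanMatrix {n : ℕ} (Q : Quiver.{v} (Fin n)) :
    Matrix (Fin n) (Fin n) ℤ :=
  fun i j => if i = j then 2 else -|exchangeMatrix Q i j|

/-- The simple root `α_i`. Elements `∑ β_i α_i` of the root lattice are represented by their
coefficient vectors `β : Fin n → ℤ`; the order `≤` of `Fin n → ℤ` is the coefficientwise one. -/
def simpleRoot {n : ℕ} (i : Fin n) : Fin n → ℤ := Pi.single i 1

/-- The simple reflection `s_i`, the additive map with `s_i α_j = α_j - a_{ij} α_i`. -/
noncomputable def simpleReflection {n : ℕ} (Q : Quiver.{v} (Fin n)) (i : Fin n)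
    (β : Fin n → ℤ) : Fin n → ℤ :=
  β - (∑ j, cartanMatrix Q i j * β j) • simpleRoot i

/-- The root system of a quiver whose Cartan matrix is of finite type: the orbit of the
simple roots under the Weyl group, i.e. under the group generated by the simple reflections
(which are involutions). -/
inductive IsRoot {n : ℕ} (Q : Quiver.{v} (Fin n)) : (Fin n → ℤ) → Prop
  | simple (i : Fin n) : IsRoot Q (simpleRoot i)
  | reflect (i : Fin n) (β : Fin n → ℤ) : IsRoot Q β → IsRoot Q (simpleReflection Q i β)

/-- The set of positive roots. -/
def positiveRoots {n : ℕ} (Q : Quiver.{v} (Fin n)) : Set (Fin n → ℤ) :=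
  {β | IsRoot Q β ∧ 0 ≤ β}

/-- The underlying unoriented graph of `Q` is, up to a relabelling of the vertices, the simple
graph `G`: there is exactly one arrow (in one of the two directions) between vertices which are
adjacent in `G`, and there is no arrow between the others (in particular there are no loops). -/
def HasUnderlyingGraph {n : ℕ} (Q : Quiver.{v} (Fin n)) (G : SimpleGraph (Fin n)) : Prop :=
  ∃ e : Equiv.Perm (Fin n), ∀ i j : Fin n,
    (G.Adj i j → Nat.card (Q.Hom (e i) (e j) ⊕ Q.Hom (e j) (e i)) = 1) ∧
    (¬ G.Adj i j → IsEmpty (Q.Hom (e i) (e j)))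

/-- The Dynkin diagram `D_n` (for `4 ≤ n`). With vertices numbered `1, …, n`, the vertex `n` is
joined to `n - 1`, `n - 2` and `n - 3`, and `1 - 2 - ⋯ - (n - 3)` is a path.
(The vertex numbered `k` is the element `k - 1` of `Fin n`.) -/
def graphD (n : ℕ) : SimpleGraph (Fin n) :=
  SimpleGraph.fromRel fun i j =>
    ((i : ℕ) + 1 = j ∧ (j : ℕ) + 4 ≤ n) ∨ ((j : ℕ) + 1 = n ∧ n ≤ (i : ℕ) + 4)

/-- Quivers of type `A_n`: the underlying graph is the path with `n ≥ 1` vertices. -/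
def IsTypeA {n : ℕ} (Q : Quiver.{v} (Fin n)) : Prop :=
  1 ≤ n ∧ HasUnderlyingGraph Q (SimpleGraph.pathGraph n)

/-- Quivers of type `D_n`, `n ≥ 4`. -/
def IsTypeD {n : ℕ} (Q : Quiver.{v} (Fin n)) : Prop :=
  4 ≤ n ∧ HasUnderlyingGraph Q (graphD n)

/-- The set `P_Q` of permutations `π` with no arrow `π a ⟶ π b` for `a > b`. -/
def permSet {n : ℕ} (Q : Quiver.{v} (Fin n)) : Set (Equiv.Perm (Fin n)) :=
  {π | ∀ a b : Fin n, b < a → IsEmpty (Q.Hom (π a) (π b))}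

/-! ### Admissible curves -/

/-- The marked points `p_1 = (1, 1), …, p_n = (n, 1)`; `Fin n` starts at `0`. -/
def markedPoint {n : ℕ} (k : Fin n) : ℝ × ℝ := ((k : ℝ) + 1, 1)

/-- The vertical ray `ρ_k` going up from the marked point `p_k`. -/
def ray {n : ℕ} (k : Fin n) : Set (ℝ × ℝ) := {z | z.1 = (k : ℝ) + 1 ∧ 1 ≤ z.2}

/-- Admissible curves `γ : [0, 1] → H = ℝ × ℝ_{≥ 0}` with base point `(0, 0)`; only the
restriction of `γ` to `[0, 1]` matters. A curve meets a vertical ray transversely at time `t`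
exactly when its velocity at `t` is not vertical. -/
structure IsAdmissible (n : ℕ) (γ : ℝ → ℝ × ℝ) : Prop where
  smooth : ContDiffOn ℝ ∞ γ (Set.Icc 0 1)
  mem_halfPlane : ∀ t ∈ Set.Icc (0 : ℝ) 1, 0 ≤ (γ t).2
  start : ∃ k : Fin n, γ 0 = markedPoint k
  finish : γ 1 = (0, 0)
  interior : ∀ t ∈ Set.Icc (0 : ℝ) 1,
    (γ t = (0, 0) ∨ ∃ k : Fin n, γ t = markedPoint k) → t = 0 ∨ t = 1
  transverse : ∀ t ∈ Set.Ioc (0 : ℝ) 1, ∀ k : Fin n, γ t ∈ ray k →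
    (derivWithin γ (Set.Icc 0 1) t).1 ≠ 0

/-- Non-self-crossing: `γ` is injective on `[0, 1]`. -/
def NonSelfCrossing (γ : ℝ → ℝ × ℝ) : Prop := Set.InjOn γ (Set.Icc 0 1)

/-- `γ` starts at `p_{k₀}` and then crosses exactly the rays `ρ_k`, `k` in the list `ks`, in this
order, as the time increases in `(0, 1]`; `τ` lists the times of the crossings. -/
def HasWord {n : ℕ} (γ : ℝ → ℝ × ℝ) (k₀ : Fin n) (ks : List (Fin n)) : Prop :=
  γ 0 = markedPoint k₀ ∧
  ∃ τ : Fin ks.length → ℝ, StrictMono τ ∧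
    ∀ (t : ℝ) (k : Fin n),
      (t ∈ Set.Ioc (0 : ℝ) 1 ∧ γ t ∈ ray k) ↔ ∃ l, τ l = t ∧ ks.get l = k

/-- `s_{π(k_m)} ⋯ s_{π(k_1)} α_{π(k₀)}` for `ks = [k_1, …, k_m]`. -/
noncomputable def wordRoot {n : ℕ} (Q : Quiver.{v} (Fin n)) (π : Equiv.Perm (Fin n))
    (k₀ : Fin n) (ks : List (Fin n)) : Fin n → ℤ :=
  ks.foldl (fun β k => simpleReflection Q (π k) β) (simpleRoot (π k₀))

/-- `α` is the associated root `α_π(γ)`: the root `s_{π(k_m)} ⋯ s_{π(k_1)} α_{π(k₀)}` read off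
from the word of `γ` if this is positive, and its opposite if it is negative. -/
def IsAssociatedRoot {n : ℕ} (Q : Quiver.{v} (Fin n)) (π : Equiv.Perm (Fin n))
    (γ : ℝ → ℝ × ℝ) (α : Fin n → ℤ) : Prop :=
  ∃ (k₀ : Fin n) (ks : List (Fin n)), HasWord γ k₀ ks ∧
    ((0 ≤ wordRoot Q π k₀ ks ∧ α = wordRoot Q π k₀ ks) ∨
      (wordRoot Q π k₀ ks ≤ 0 ∧ α = -wordRoot Q π k₀ ks))

/-- `γ` is non-decreasing with respect to `π`: along the word of `γ`,
`s_{π(k_{i+1})} ⋯ s_{π(k_1)} α_{π(k₀)} ≥ s_{π(k_i)} ⋯ s_{π(k_1)} α_{π(k₀)}` at every step. -/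
def NonDecreasing {n : ℕ} (Q : Quiver.{v} (Fin n)) (π : Equiv.Perm (Fin n))
    (γ : ℝ → ℝ × ℝ) : Prop :=
  ∃ (k₀ : Fin n) (ks : List (Fin n)), HasWord γ k₀ ks ∧
    ∀ i < ks.length, wordRoot Q π k₀ (ks.take i) ≤ wordRoot Q π k₀ (ks.take (i + 1))

/-- `{α_π(γ) | γ ∈ Γ_{π,nd}}`: the associated roots of the non-decreasing non-self-crossing
admissible curves with respect to `π`. -/
def nonDecreasingRoots {n : ℕ} (Q : Quiver.{v} (Fin n)) (π : Equiv.Perm (Fin n)) :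
    Set (Fin n → ℤ) :=
  {α | ∃ γ : ℝ → ℝ × ℝ, IsAdmissible n γ ∧ NonSelfCrossing γ ∧ NonDecreasing Q π γ ∧
    IsAssociatedRoot Q π γ α}

end AdmissibleCurve

/-! One inclusion is formal: words yield roots, and the roots are closed under negation. For the
other, a positive root `β` is taken apart by reading the wanted curve backwards, from the base point
to its start. The curve is a spiral, which meets the marked points cyclically, in increasing or in
decreasing order. When it meets `p_k`, the current root is reflected at `π k` if its coefficient
there is nonzero (the spiral passes above `p_k` and crosses the ray); otherwise nothing happens (it
passes below). Once the sweep is at the simple root of the vertex being met, the curve starts at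
that marked point.

The sweep must never go up, which it would do only at an ascent: a vertex `v` of the support with
negative pairing `(C *ᵥ β) v`. Writing the norm as a sum of squares shows that a positive root has
no ascent in type `A`, and at most one in type `D`, next to a vertex of pairing `1`. If this
neighbour is met first, its reflection raises the pairing at the ascent from `-1` to `0`. One of the
two orientations of the spiral ensures this at the beginning (`exists_descentFirst`). It then
persists (`IsSweepable.sweep_step`), because a new ascent can only be the vertex just reflected,
which is not met again before all the others. Definiteness of the norm makes the sweep end
(`IsSweepable.exists_sweep_eq_simpleRoot`).

On the geometric side, coefficients only decrease during the sweep, so the crossings of a given ray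
belong to the outermost turns. Each marked point can thus be put at a height separating the crossed
turns from the others (`exists_heights`), and a shear then brings all marked points to height `1`
(`exists_spiral_curve`). -/

namespace AdmissibleCurve

open Matrix

/-! ### Sweeping a root down to a simple root -/

section Sweep

variable {n : ℕ}

/-- The reflection `s_i` attached to a Cartan matrix. -/
def reflection (C : Matrix (Fin n) (Fin n) ℤ) (i : Fin n) (β : Fin n → ℤ) : Fin n → ℤ :=
  β - (C *ᵥ β) i • simpleRoot i

/-- The norm `∑ β_i a_{ij} β_j`. -/
def cartanNorm (C : Matrix (Fin n) (Fin n) ℤ) (β : Fin n → ℤ) : ℤ := β ⬝ᵥ (C *ᵥ β)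

/-- A vertex of the support of `β` at which the reflection increases `β`. -/
def IsAscent (C : Matrix (Fin n) (Fin n) ℤ) (β : Fin n → ℤ) (v : Fin n) : Prop :=
  0 < β v ∧ (C *ᵥ β) v < 0

/-- The properties of the Cartan matrices of type `A` and `D` that are used to sweep down roots. -/
structure IsSweepable (C : Matrix (Fin n) (Fin n) ℤ) : Prop where
  symm : ∀ i j, C i j = C j i
  diag : ∀ i, C i i = 2
  offDiag : ∀ i j, i ≠ j → C i j = 0 ∨ C i j = -1
  nonneg : ∀ β, 0 ≤ cartanNorm C β
  definite : ∀ β, cartanNorm C β = 0 → β = 0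
  exists_descent : ∀ β, 0 ≤ β → cartanNorm C β = 2 → ∀ v, IsAscent C β v →
    ∃ w, C v w = -1 ∧ (C *ᵥ β) w = 1
  ascent_unique : ∀ β, 0 ≤ β → cartanNorm C β = 2 → ∀ v w, IsAscent C β v → IsAscent C β w → v = w

lemma mulVec_simpleRoot (C : Matrix (Fin n) (Fin n) ℤ) (i j : Fin n) :
    (C *ᵥ simpleRoot j) i = C i j := by
  simp [simpleRoot]

lemma cartanNorm_sub_smul {C : Matrix (Fin n) (Fin n) ℤ} (hs : ∀ i j, C i j = C j i)
    (hd : ∀ i, C i i = 2) (β : Fin n → ℤ) (j : Fin n) (c : ℤ) :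
    cartanNorm C (β - c • simpleRoot j) =
      cartanNorm C β - 2 * c * (C *ᵥ β) j + 2 * c ^ 2 := by
  have h1 : β ⬝ᵥ (C *ᵥ simpleRoot j) = (C *ᵥ β) j := by
    rw [show C *ᵥ simpleRoot j = fun i => C i j from funext fun i => mulVec_simpleRoot C i j]
    simp only [dotProduct, mulVec]
    exact Finset.sum_congr rfl fun i _ => by rw [hs i j, mul_comm]
  have h2 : ∀ w : Fin n → ℤ, simpleRoot j ⬝ᵥ w = w j := by
    intro w; simp [simpleRoot]
  unfold cartanNorm
  rw [mulVec_sub, mulVec_smul, sub_dotProduct, dotProduct_sub, dotProduct_sub, dotProduct_smul,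
    smul_dotProduct, smul_dotProduct, dotProduct_smul, h1, h2, h2, mulVec_simpleRoot, hd]
  simp only [smul_eq_mul]
  ring

lemma cartanNorm_reflection {C : Matrix (Fin n) (Fin n) ℤ} (hs : ∀ i j, C i j = C j i)
    (hd : ∀ i, C i i = 2) (β : Fin n → ℤ) (i : Fin n) :
    cartanNorm C (reflection C i β) = cartanNorm C β := by
  rw [reflection, cartanNorm_sub_smul hs hd]; ring

lemma cartanNorm_simpleRoot {C : Matrix (Fin n) (Fin n) ℤ} (hd : ∀ i, C i i = 2) (i : Fin n) :
    cartanNorm C (simpleRoot i) = 2 := by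
  unfold cartanNorm
  have : simpleRoot i ⬝ᵥ (C *ᵥ simpleRoot i) = (C *ᵥ simpleRoot i) i := by simp [simpleRoot]
  rw [this, mulVec_simpleRoot, hd]

lemma reflection_reflection {C : Matrix (Fin n) (Fin n) ℤ}
    (hd : ∀ i, C i i = 2) (β : Fin n → ℤ) (i : Fin n) :
    reflection C i (reflection C i β) = β := by
  have : (C *ᵥ reflection C i β) i = - (C *ᵥ β) i := by
    unfold reflection
    rw [mulVec_sub, mulVec_smul, Pi.sub_apply, Pi.smul_apply, mulVec_simpleRoot, hd]
    simp only [smul_eq_mul]; ring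
  rw [reflection, this, reflection]
  simp

variable {C : Matrix (Fin n) (Fin n) ℤ}

/-- With a pairing of at least `2`, subtracting `α_j` would bring the norm from `2` down to at most
`0`, and definiteness gives `β = α_j`. The next lemma adds `α_j` instead. -/
lemma IsSweepable.mulVec_le_one (h : IsSweepable C) {β : Fin n → ℤ} (hN : cartanNorm C β = 2)
    {j : Fin n} (hj : β ≠ simpleRoot j) : (C *ᵥ β) j ≤ 1 := by
  by_contra hlt
  have h1 := cartanNorm_sub_smul h.symm h.diag β j 1
  have h2 := h.nonneg (β - (1 : ℤ) • simpleRoot j)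
  have h3 := h.definite (β - (1 : ℤ) • simpleRoot j) (by omega)
  rw [one_smul] at h3
  exact hj (sub_eq_zero.mp h3)

lemma IsSweepable.neg_one_le_mulVec (h : IsSweepable C) {β : Fin n → ℤ} (h0 : 0 ≤ β)
    (hN : cartanNorm C β = 2) (j : Fin n) : -1 ≤ (C *ᵥ β) j := by
  by_contra hlt
  have h1 := cartanNorm_sub_smul h.symm h.diag β j (-1)
  have h2 := h.nonneg (β - (-1 : ℤ) • simpleRoot j)
  have h3 := congrFun (h.definite (β - (-1 : ℤ) • simpleRoot j) (by omega)) j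
  have h4 := h0 j
  simp [simpleRoot] at h3 h4
  omega

/-- Going down from `β` along the sequence of vertices `P`: each vertex of the support of the
current vector is reflected. -/
def sweep (C : Matrix (Fin n) (Fin n) ℤ) (P : ℕ → Fin n) (β : Fin n → ℤ) : ℕ → (Fin n → ℤ)
  | 0 => β
  | u + 1 => if sweep C P β u (P u) = 0 then sweep C P β u
      else reflection C (P u) (sweep C P β u)

/-- Each ascent of `β` has a neighbour which is a descent and is met before it after time `u`. -/
def DescentFirst (C : Matrix (Fin n) (Fin n) ℤ) (P : ℕ → Fin n) (β : Fin n → ℤ) (u : ℕ) : Prop :=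
  ∀ v, IsAscent C β v → ∃ w, C v w = -1 ∧ (C *ᵥ β) w = 1 ∧
    ∃ x, u ≤ x ∧ P x = w ∧ ∀ y, u ≤ y → y ≤ x → P y ≠ v

lemma mulVec_sub_simpleRoot (C : Matrix (Fin n) (Fin n) ℤ) (β : Fin n → ℤ) (i j : Fin n) :
    (C *ᵥ (β - simpleRoot j)) i = (C *ᵥ β) i - C i j := by
  rw [mulVec_sub, Pi.sub_apply, mulVec_simpleRoot]

/-- A sequence of vertices in which any `n` consecutive terms are all the vertices. -/
structure IsCyclic (P : ℕ → Fin n) : Prop where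
  exists_mem : ∀ u v, ∃ x, u ≤ x ∧ x < u + n ∧ P x = v
  ne_of_lt : ∀ x y, x < y → y < x + n → P x ≠ P y

lemma IsSweepable.sweep_step (h : IsSweepable C) {P : ℕ → Fin n} (hP : IsCyclic P)
    {β : Fin n → ℤ} {u : ℕ} (h0 : 0 ≤ β) (hN : cartanNorm C β = 2) (hD : DescentFirst C P β u)
    (hne : β ≠ simpleRoot (P u)) {β' : Fin n → ℤ}
    (hβ' : β' = if β (P u) = 0 then β else reflection C (P u) β) :
    0 ≤ β' ∧ cartanNorm C β' = 2 ∧ β' ≤ β ∧ DescentFirst C P β' (u + 1) := by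
  -- For the steps that leave `β` unchanged: the descent promised for a later time is not at `P u`,
  -- where the pairing is not `1`.
  have keep : (C *ᵥ β) (P u) ≠ 1 → ¬ IsAscent C β (P u) → DescentFirst C P β (u + 1) := by
    intro h1 _ v hv
    obtain ⟨w, hw, hw1, x, hx, hPx, hy⟩ := hD v hv
    refine ⟨w, hw, hw1, x, ?_, hPx, fun y hy1 hy2 => hy y (by omega) hy2⟩
    rcases hx.eq_or_lt with rfl | hlt
    · rw [hPx] at h1; exact absurd hw1 h1
    · exact hlt
  -- The invariant at `y = u`: an ascent cannot be met before its descent.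
  have hnot : ¬ IsAscent C β (P u) := by
    intro hv
    obtain ⟨w, hw, hw1, x, hx, hPx, hy⟩ := hD _ hv
    exact hy u le_rfl hx rfl
  by_cases hz : β (P u) = 0
  · rw [if_pos hz] at hβ'
    subst hβ'
    refine ⟨h0, hN, le_rfl, keep ?_ hnot⟩
    intro h1
    have hle : (C *ᵥ β') (P u) ≤ 0 := by
      simp only [mulVec, dotProduct]
      apply Finset.sum_nonpos
      intro j _
      by_cases hj : P u = j
      · rw [← hj, hz]; simp
      · have := h0 j
        simp only [Pi.zero_apply] at this
        rcases h.offDiag _ _ hj with h2 | h2 <;> rw [h2] <;> omega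
    omega
  · rw [if_neg hz] at hβ'
    have hpos : 0 < β (P u) := lt_of_le_of_ne (h0 _) (Ne.symm hz)
    have hle := h.mulVec_le_one hN hne
    have hge : 0 ≤ (C *ᵥ β) (P u) := by
      by_contra hlt
      exact hnot ⟨hpos, by omega⟩
    have hN' : cartanNorm C β' = 2 := by
      rw [hβ', cartanNorm_reflection h.symm h.diag, hN]
    rcases (by omega : (C *ᵥ β) (P u) = 0 ∨ (C *ᵥ β) (P u) = 1) with h1 | h1
    · have : β' = β := by rw [hβ', reflection, h1]; simp
      rw [this]
      exact ⟨h0, hN, le_rfl, keep (by omega) hnot⟩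
    · have hb : β' = β - simpleRoot (P u) := by rw [hβ', reflection, h1, one_smul]
      have h0' : 0 ≤ β' := by
        intro i
        rw [hb]
        by_cases hi : i = P u
        · subst hi
          simp [simpleRoot]; omega
        · simpa [simpleRoot, hi] using h0 i
      refine ⟨h0', hN', ?_, ?_⟩
      · rw [hb]
        intro i
        by_cases hi : i = P u
        · subst hi
          simp [simpleRoot]
        · simp [simpleRoot, hi]
      · intro v hv
        -- The vertex just reflected may have become an ascent, but it is not met again before time
        -- `u + n`, and its descent neighbour is met in between.
        by_cases hvu : v = P u
        · obtain ⟨w, hw, hw1⟩ := h.exists_descent β' h0' hN' v hv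
          obtain ⟨x, hx1, hx2, hx3⟩ := hP.exists_mem (u + 1) w
          refine ⟨w, hw, hw1, x, hx1, hx3, fun y hy1 hy2 => ?_⟩
          have hxu : x ≠ u + n := by
            intro hxe
            obtain ⟨x', hx1', hx2', hx3'⟩ := hP.exists_mem u w
            rcases hx1'.eq_or_lt with he | hlt
            · rw [← hx3', ← he, ← hvu, h.diag] at hw; omega
            · exact hP.ne_of_lt x' x (by omega) (by omega) (by rw [hx3, hx3'])
          rw [hvu]
          exact (hP.ne_of_lt u y (by omega) (by omega)).symm
        -- Any other ascent is an old one: a neighbour of `P u` had its pairing raised from at least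
        -- `-1` to at least `0`.
        · have hv2 := hv.2
          have hv1 := hv.1
          rw [hb, mulVec_sub_simpleRoot] at hv2
          have hvβ : β v = β' v := by rw [hb]; simp [simpleRoot, hvu]
          have hge1 := h.neg_one_le_mulVec h0 hN v
          have hadj : C v (P u) = 0 := by
            rcases h.offDiag _ _ hvu with h2 | h2
            · exact h2
            · omega
          obtain ⟨w, hw, hw1, x, hx, hPx, hy⟩ := hD v ⟨by omega, by omega⟩
          have hwu : w ≠ P u := by rintro rfl; omega
          -- If `w` were adjacent to `P u`, its pairing would rise to `2`, so `β'` would be `α_w`,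
          -- whose support does not contain `v`.
          have hwadj : C w (P u) = 0 := by
            rcases h.offDiag _ _ hwu with h2 | h2
            · exact h2
            · exfalso
              have h3 : (C *ᵥ β') w = 2 := by rw [hb, mulVec_sub_simpleRoot]; omega
              have h4 : β' = simpleRoot w := by
                by_contra hne'
                have := h.mulVec_le_one hN' hne'
                omega
              have h5 := hv.1
              have hvw : v ≠ w := by
                rintro rfl
                rw [h.diag] at hw; omega
              rw [h4] at h5
              simp [simpleRoot, hvw] at h5
          refine ⟨w, hw, ?_, x, ?_, hPx, fun y hy1 hy2 => hy y (by omega) hy2⟩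
          · rw [hb, mulVec_sub_simpleRoot]; omega
          · rcases hx.eq_or_lt with he | hlt
            · exact absurd (by rw [← hPx, he]) hwu
            · exact hlt

/-- The sweep reaches a simple root at the moment at which its vertex is met. -/
lemma IsSweepable.exists_sweep_eq_simpleRoot (h : IsSweepable C) {P : ℕ → Fin n}
    (hP : IsCyclic P) {β : Fin n → ℤ} (h0 : 0 ≤ β) (hN : cartanNorm C β = 2)
    (hD : DescentFirst C P β 0) :
    ∃ U, sweep C P β U = simpleRoot (P U) ∧
      ∀ u < U, 0 ≤ sweep C P β (u + 1) ∧ sweep C P β (u + 1) ≤ sweep C P β u := by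
  have inv : ∀ U, (∀ u < U, sweep C P β u ≠ simpleRoot (P u)) →
      0 ≤ sweep C P β U ∧ cartanNorm C (sweep C P β U) = 2 ∧ DescentFirst C P (sweep C P β U) U := by
    intro U
    induction U with
    | zero => intro _; exact ⟨h0, hN, hD⟩
    | succ U ih =>
      intro hU
      obtain ⟨a, b, c⟩ := ih fun u hu => hU u (by omega)
      obtain ⟨a', b', _, c'⟩ := h.sweep_step hP a b c (hU U (by omega)) (β' := sweep C P β (U + 1)) rfl
      exact ⟨a', b', c'⟩
  have step : ∀ U, (∀ u < U, sweep C P β u ≠ simpleRoot (P u)) →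
      ∀ u < U, 0 ≤ sweep C P β (u + 1) ∧ sweep C P β (u + 1) ≤ sweep C P β u := by
    intro U hU u hu
    obtain ⟨a, b, c⟩ := inv u fun u' hu' => hU u' (by omega)
    obtain ⟨a', _, d', _⟩ := h.sweep_step hP a b c (hU u hu) (β' := sweep C P β (u + 1)) rfl
    exact ⟨a', d'⟩
  by_cases hex : ∃ U, sweep C P β U = simpleRoot (P U)
  · classical
    exact ⟨Nat.find hex, Nat.find_spec hex, step _ fun u hu => Nat.find_min hex hu⟩
  · exfalso
    push Not at hex
    have hstep : ∀ u, 0 ≤ sweep C P β (u + 1) ∧ sweep C P β (u + 1) ≤ sweep C P β u :=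
      fun u => step (u + 1) (fun u' _ => hex u') u (by omega)
    have hinv := fun U => inv U (fun u _ => hex u)
    -- A sweep that never stops is constant once the sum of the coefficients is minimal. All
    -- vertices of the support are still met, so their pairings vanish and the norm is `0`, not `2`.
    obtain ⟨u₀, hu₀⟩ : ∃ u₀, ∀ u, u₀ ≤ u →
        ∑ i, (sweep C P β u₀ i).toNat ≤ ∑ i, (sweep C P β u i).toNat := by
      let f : ℕ → ℕ := fun u => ∑ i, (sweep C P β u i).toNat
      obtain ⟨m, hm⟩ : ∃ u, ∀ w, f u ≤ f w := by
        have := WellFounded.has_min (measure f).wf Set.univ ⟨0, trivial⟩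
        obtain ⟨m, _, hm⟩ := this
        exact ⟨m, fun w => not_lt.mp (hm w trivial)⟩
      exact ⟨m, fun u _ => hm u⟩
    have hconst : ∀ u, u₀ ≤ u → sweep C P β u = sweep C P β u₀ := by
      intro u hu
      induction u, hu using Nat.le_induction with
      | base => rfl
      | succ u hu ih =>
        have hle := (hstep u).2
        have hnn := (hstep u).1
        rw [ih] at hle
        have hs := hu₀ (u + 1) (by omega)
        have heq : ∀ i ∈ Finset.univ, (sweep C P β (u + 1) i).toNat = (sweep C P β u₀ i).toNat := by
          refine (Finset.sum_eq_sum_iff_of_le fun i _ => Int.toNat_le_toNat (hle i)).mp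
            (le_antisymm (Finset.sum_le_sum fun i _ => Int.toNat_le_toNat (hle i)) hs)
        funext i
        have h1 := heq i (Finset.mem_univ i)
        have h2 := hnn i
        have h3 := (hinv u₀).1 i
        simp only [Pi.zero_apply] at h2 h3
        omega
    have hzero : cartanNorm C (sweep C P β u₀) = 0 := by
      unfold cartanNorm dotProduct
      apply Finset.sum_eq_zero
      intro i _
      by_cases hi : sweep C P β u₀ i = 0
      · rw [hi, zero_mul]
      · obtain ⟨x, hx, _, rfl⟩ := hP.exists_mem u₀ i
        have h1 := hconst (x + 1) (by omega)
        rw [sweep, hconst x hx, if_neg hi, reflection] at h1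
        have h2 := congrFun h1 (P x)
        simp [simpleRoot] at h2
        rw [h2, mul_zero]
    have := (hinv u₀).2.1
    omega

end Sweep

open Matrix

/-! ### The Cartan matrices of type `A` and `D` are sweepable -/

section CartanTypes

variable {n : ℕ}

/-- The Cartan matrix of a simple graph. -/
def graphCartan (G : SimpleGraph (Fin n)) [DecidableRel G.Adj] : Matrix (Fin n) (Fin n) ℤ :=
  fun i j => if i = j then 2 else if G.Adj i j then -1 else 0

lemma cartanMatrix_eq_graphCartan {Q : Quiver.{v} (Fin n)} {G : SimpleGraph (Fin n)}
    [DecidableRel G.Adj] (e : Equiv.Perm (Fin n))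
    (he : ∀ i j : Fin n, (G.Adj i j → Nat.card (Q.Hom (e i) (e j) ⊕ Q.Hom (e j) (e i)) = 1) ∧
      (¬ G.Adj i j → IsEmpty (Q.Hom (e i) (e j)))) (i j : Fin n) :
    cartanMatrix Q (e i) (e j) = graphCartan G i j := by
  unfold cartanMatrix graphCartan exchangeMatrix
  by_cases hij : i = j
  · simp [hij]
  · rw [if_neg hij, if_neg (by simpa using hij)]
    by_cases ha : G.Adj i j
    · rw [if_pos ha]
      have h1 := (he i j).1 ha
      have hf : Finite (Q.Hom (e i) (e j) ⊕ Q.Hom (e j) (e i)) :=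
        Nat.finite_of_card_ne_zero (by omega)
      have hf1 : Finite (Q.Hom (e i) (e j)) := Finite.sum_left (Q.Hom (e j) (e i))
      have hf2 : Finite (Q.Hom (e j) (e i)) := Finite.sum_right (Q.Hom (e i) (e j))
      rw [Nat.card_sum] at h1
      rcases (by omega : (Nat.card (Q.Hom (e i) (e j)) = 1 ∧ Nat.card (Q.Hom (e j) (e i)) = 0) ∨
        (Nat.card (Q.Hom (e i) (e j)) = 0 ∧ Nat.card (Q.Hom (e j) (e i)) = 1)) with ⟨a, b⟩ | ⟨a, b⟩
      <;> rw [a, b] <;> rfl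
    · rw [if_neg ha]
      have h1 := (he i j).2 ha
      have h2 := (he j i).2 (fun h => ha h.symm)
      simp

lemma IsSweepable.of_equiv {C D : Matrix (Fin n) (Fin n) ℤ} (e : Equiv.Perm (Fin n))
    (he : ∀ i j, C (e i) (e j) = D i j) (h : IsSweepable D) : IsSweepable C := by
  have hC : ∀ i j, C i j = D (e.symm i) (e.symm j) := fun i j => by
    rw [← he, e.apply_symm_apply, e.apply_symm_apply]
  have hm : ∀ β i, (C *ᵥ β) i = (D *ᵥ (β ∘ e)) (e.symm i) := by
    intro β i
    simp only [mulVec, dotProduct]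
    rw [← Equiv.sum_comp e]
    exact Finset.sum_congr rfl fun j _ => by rw [hC, e.symm_apply_apply]; rfl
  have hN : ∀ β, cartanNorm C β = cartanNorm D (β ∘ e) := by
    intro β
    unfold cartanNorm dotProduct
    rw [← Equiv.sum_comp e]
    exact Finset.sum_congr rfl fun j _ => by rw [hm, e.symm_apply_apply]; rfl
  have hA : ∀ β v, IsAscent C β v → IsAscent D (β ∘ e) (e.symm v) := by
    rintro β v ⟨h1, h2⟩
    exact ⟨by simpa using h1, by rwa [hm] at h2⟩
  refine ⟨fun i j => ?_, fun i => ?_, fun i j hij => ?_, fun β => ?_, fun β hβ => ?_,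
    fun β h0 h2 v hv => ?_, fun β h0 h2 v w hv hw => ?_⟩
  · rw [hC, hC, h.symm]
  · rw [hC, h.diag]
  · rw [hC]; exact h.offDiag _ _ (by simpa using hij)
  · rw [hN]; exact h.nonneg _
  · rw [hN] at hβ
    have := h.definite _ hβ
    funext i
    simpa using congrFun this (e.symm i)
  · rw [hN] at h2
    obtain ⟨w, hw, hw1⟩ := h.exists_descent _ (fun i => h0 (e i)) h2 _ (hA _ _ hv)
    exact ⟨e w, by rw [hC, e.symm_apply_apply, hw], by rw [hm, e.symm_apply_apply]; exact hw1⟩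
  · rw [hN] at h2
    exact e.symm.injective
      (h.ascent_unique _ (fun i => h0 (e i)) h2 _ _ (hA _ _ hv) (hA _ _ hw))

/-- The consecutive differences of a sequence, preceded by its first term. -/
def increment (B : ℕ → ℤ) : ℕ → ℤ
  | 0 => B 0
  | k + 1 => B (k + 1) - B k

/-- The sum of the squares of the increments up to index `k`. -/
def energy (B : ℕ → ℤ) (k : ℕ) : ℤ := ∑ i ∈ Finset.range (k + 1), increment B i ^ 2

lemma energy_succ (B : ℕ → ℤ) (k : ℕ) :
    energy B (k + 1) = energy B k + (B (k + 1) - B k) ^ 2 := by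
  unfold energy; rw [Finset.sum_range_succ]; rfl

lemma energy_zero (B : ℕ → ℤ) : energy B 0 = B 0 ^ 2 := by
  simp [energy, increment]

lemma energy_nonneg (B : ℕ → ℤ) (k : ℕ) : 0 ≤ energy B k :=
  Finset.sum_nonneg fun _ _ => sq_nonneg _

lemma int_le_sq (a : ℤ) : a ≤ a ^ 2 := by nlinarith [Int.le_self_sq a]

/-- The value is the sum of the increments, and an integer is at most its square. -/
lemma le_energy (B : ℕ → ℤ) (k : ℕ) : B k ≤ energy B k := by
  induction k with
  | zero => rw [energy_zero]; exact int_le_sq _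
  | succ k ih => rw [energy_succ]; have := int_le_sq (B (k + 1) - B k); omega

lemma sub_le_energy_sub (B : ℕ → ℤ) {j k : ℕ} (h : j ≤ k) :
    |B k - B j| ≤ energy B k - energy B j := by
  induction k, h using Nat.le_induction with
  | base => simp
  | succ k _ ih =>
    rw [energy_succ]
    have h1 := int_le_sq (B (k + 1) - B k)
    have h2 := int_le_sq (B k - B (k + 1))
    have h3 : (B k - B (k + 1)) ^ 2 = (B (k + 1) - B k) ^ 2 := by ring
    rw [abs_le] at *
    omega

lemma energy_mono (B : ℕ → ℤ) {j k : ℕ} (h : j ≤ k) : energy B j ≤ energy B k := by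
  have := (abs_nonneg _).trans (sub_le_energy_sub B h); omega

lemma eq_zero_of_energy_eq_zero (B : ℕ → ℤ) {j k : ℕ} (h : j ≤ k) (hk : energy B k = 0) :
    B j = 0 := by
  have h1 := energy_mono B h
  have h2 := energy_nonneg B j
  have h3 := le_energy B j
  have h4 := le_energy (fun i => - B i) j
  have h5 : energy (fun i => - B i) j = energy B j := by
    unfold energy
    refine Finset.sum_congr rfl fun i _ => ?_
    cases i <;> simp only [increment] <;> ring
  omega

/-- Summation by parts. -/
lemma sum_mul_increment (B : ℕ → ℤ) (k : ℕ) :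
    ∑ i ∈ Finset.range (k + 1), B i * (increment B i - increment B (i + 1)) =
      energy B k - B k * increment B (k + 1) := by
  induction k with
  | zero => simp [energy, increment]; ring
  | succ k ih => rw [Finset.sum_range_succ, ih, energy_succ]; simp only [increment]; ring

/-- At a positive place where the increments go up, two increments are `1` and no other is
nonzero. -/
lemma increment_of_ascent {B : ℕ → ℤ} {k : ℕ} (h0 : ∀ i ≤ k, 0 ≤ B i) (hk : 0 < B k)
    (hlt : increment B k - increment B (k + 1) < 0) (hE : energy B (k + 1) ≤ 2) :
    energy B k = 1 ∧ energy B (k + 1) = 2 ∧ B k = 1 ∧ B (k + 1) = 2 := by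
  have hBE := le_energy B k
  rw [energy_succ] at hE
  have hd : increment B (k + 1) = B (k + 1) - B k := rfl
  rw [hd] at hlt
  have hsq : (B (k + 1) - B k) ^ 2 ≤ 1 := by omega
  obtain ⟨hl, hr⟩ := abs_le.mp ((sq_le_one_iff_abs_le_one _).mp hsq)
  -- Falling to a positive value requires a height of at least `2` before: energy at least `2` for
  -- the climb and `1` for the fall.
  have hinc : 0 ≤ increment B k := by
    cases k with
    | zero => exact h0 0 le_rfl
    | succ k =>
      by_contra hneg
      have h1 := le_energy B k
      rw [energy_succ] at hE
      simp only [increment] at hneg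
      have h3 : 1 ≤ (B (k + 1) - B k) ^ 2 := by nlinarith
      have := sq_nonneg (B (k + 1 + 1) - B (k + 1))
      omega
  have h1 : B (k + 1) - B k = 1 := by omega
  rw [h1] at hE
  rw [energy_succ, h1]
  omega

/-- A vector on `Fin n` as a sequence vanishing from `n` on. -/
def extend (β : Fin n → ℤ) (k : ℕ) : ℤ := if h : k < n then β ⟨k, h⟩ else 0

lemma extend_val (β : Fin n → ℤ) (i : Fin n) : extend β i = β i := by simp [extend]

lemma extend_of_le (β : Fin n → ℤ) {k : ℕ} (h : n ≤ k) : extend β k = 0 := by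
  simp [extend, not_lt.mpr h]

instance : DecidableRel (SimpleGraph.pathGraph n).Adj := fun _ _ =>
  decidable_of_iff _ SimpleGraph.pathGraph_adj.symm

/-- The ends of the path need no separate formula: `increment` treats the term before index `0` as
zero, and `extend` makes the term at index `n` zero. -/
lemma pathCartan_mulVec (β : Fin n → ℤ) (i : Fin n) :
    (graphCartan (SimpleGraph.pathGraph n) *ᵥ β) i =
      increment (extend β) i - increment (extend β) (i + 1) := by
  have h1 : ∀ j : Fin n, graphCartan (SimpleGraph.pathGraph n) i j * β j =
      (if (j : ℕ) = i then 2 * extend β j else 0) - (if (j : ℕ) = i + 1 then extend β j else 0) -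
        (if (j : ℕ) + 1 = i then extend β j else 0) := by
    intro j
    simp only [graphCartan, SimpleGraph.pathGraph_adj, extend_val, Fin.ext_iff]
    split_ifs <;> omega
  simp only [mulVec, dotProduct]
  rw [Finset.sum_congr rfl fun j _ => h1 j,
    Fin.sum_univ_eq_sum_range (fun k => (if k = (i : ℕ) then 2 * extend β k else 0) -
      (if k = i + 1 then extend β k else 0) - (if k + 1 = i then extend β k else 0)),
    Finset.sum_sub_distrib, Finset.sum_sub_distrib, Finset.sum_ite_eq', Finset.sum_ite_eq',
    if_pos (Finset.mem_range.mpr i.2)]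
  have h2 : (if (i : ℕ) + 1 ∈ Finset.range n then extend β (i + 1) else 0) = extend β (i + 1) := by
    split_ifs with h
    · rfl
    · rw [extend_of_le β (by simpa using h)]
  rw [h2]
  have h3 := i.2
  generalize (i : ℕ) = k at *
  cases k with
  | zero => simp [increment]; ring
  | succ k =>
    simp only [Nat.add_right_cancel_iff]
    rw [Finset.sum_ite_eq', if_pos (Finset.mem_range.mpr (by omega))]
    simp only [increment]; ring

lemma cartanNorm_path (β : Fin n → ℤ) :
    cartanNorm (graphCartan (SimpleGraph.pathGraph n)) β = energy (extend β) n := by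
  unfold cartanNorm dotProduct
  rw [Finset.sum_congr rfl fun i _ => by rw [pathCartan_mulVec, ← extend_val β i],
    Fin.sum_univ_eq_sum_range (fun k => extend β k *
      (increment (extend β) k - increment (extend β) (k + 1)))]
  cases n with
  | zero => simp [energy, increment, extend]
  | succ m =>
    rw [sum_mul_increment, energy_succ]
    simp only [increment]
    rw [extend_of_le β (le_refl (m + 1))]
    ring

lemma isSweepable_path : IsSweepable (graphCartan (SimpleGraph.pathGraph n)) := by
  have noAscent : ∀ β, 0 ≤ β → cartanNorm (graphCartan (SimpleGraph.pathGraph n)) β = 2 →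
      ∀ v, ¬ IsAscent (graphCartan (SimpleGraph.pathGraph n)) β v := by
    rintro β h0 h2 v ⟨hv, hv'⟩
    rw [cartanNorm_path] at h2
    rw [pathCartan_mulVec] at hv'
    rw [← extend_val β] at hv
    have h0' : ∀ i, 0 ≤ extend β i := by
      intro i; unfold extend; split_ifs
      · exact h0 _
      · exact le_rfl
    have hE := energy_mono (extend β) (show (v : ℕ) + 1 ≤ n from v.2)
    -- At an ascent the whole energy `2` is spent on reaching the value `2`; none is left to return
    -- to `0` at index `n`.
    obtain ⟨-, h3, -, h4⟩ := increment_of_ascent (fun i _ => h0' i) hv hv' (by omega)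
    have h5 := sub_le_energy_sub (extend β) (show (v : ℕ) + 1 ≤ n from v.2)
    rw [extend_of_le β le_rfl, abs_le] at h5
    omega
  refine ⟨fun i j => ?_, fun i => ?_, fun i j hij => ?_, fun β => ?_, fun β hβ => ?_,
    fun β h0 h2 v hv => absurd hv (noAscent β h0 h2 v),
    fun β h0 h2 v w hv => absurd hv (noAscent β h0 h2 v)⟩
  · simp only [graphCartan, eq_comm (a := i), SimpleGraph.adj_comm _ i]
  · simp [graphCartan]
  · simp only [graphCartan, if_neg hij]; split_ifs <;> simp
  · rw [cartanNorm_path]; exact energy_nonneg _ _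
  · rw [cartanNorm_path] at hβ
    funext i
    rw [← extend_val β]
    exact eq_zero_of_energy_eq_zero _ i.2.le hβ

/-! ### Type `D`: the norm as a sum of squares, and the ascents of roots. -/

variable {m : ℕ}

lemma graphD_adj (i j : Fin (m + 4)) : (graphD (m + 4)).Adj i j ↔
    ((i : ℕ) + 1 = j ∧ (j : ℕ) ≤ m) ∨ ((j : ℕ) + 1 = i ∧ (i : ℕ) ≤ m) ∨
      ((j : ℕ) = m + 3 ∧ m ≤ i ∧ (i : ℕ) < m + 3) ∨
      ((i : ℕ) = m + 3 ∧ m ≤ j ∧ (j : ℕ) < m + 3) := by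
  simp only [graphD, SimpleGraph.fromRel_adj, ne_eq, Fin.ext_iff]
  omega

instance : DecidableRel (graphD (m + 4)).Adj := fun i j =>
  decidable_of_iff _ (graphD_adj i j).symm

/-- The coefficients of a vector along the long leg of `D_n` up to the branch vertex, followed
by the sum of the coefficients at the two short legs. -/
def legSequence (β : Fin (m + 4) → ℤ) (k : ℕ) : ℤ :=
  if k ≤ m then extend β k else if k = m + 1 then extend β (m + 3)
    else extend β (m + 1) + extend β (m + 2)

/-- The pairings with the simple roots, as a sequence. -/
def pairingD (β : Fin (m + 4) → ℤ) : ℕ → ℤ := extend (graphCartan (graphD (m + 4)) *ᵥ β)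

lemma sum_graphCartan_eq (β : Fin (m + 4) → ℤ) (i : Fin (m + 4)) (F : ℕ → ℤ)
    (hF : ∀ j : Fin (m + 4), graphCartan (graphD (m + 4)) i j * β j = F j) :
    pairingD β i = ∑ j ∈ Finset.range (m + 4), F j := by
  rw [pairingD, extend_val, ← Fin.sum_univ_eq_sum_range, mulVec, dotProduct]
  exact Finset.sum_congr rfl fun j _ => hF j

lemma pairingD_leg (β : Fin (m + 4) → ℤ) {k : ℕ} (hk : k ≤ m) :
    pairingD β k = increment (legSequence β) k - increment (legSequence β) (k + 1) := by
  -- `s` is the next vertex towards the short legs; after `m` this is the branch vertex `m + 3`.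
  obtain ⟨s, hs, hs'⟩ : ∃ s, (k < m → s = k + 1) ∧ (k = m → s = m + 3) :=
    ⟨if k < m then k + 1 else m + 3, fun h => if_pos h, fun h => if_neg (by omega)⟩
  have hsm : s < m + 4 := by omega
  rw [show k = ((⟨k, by omega⟩ : Fin (m + 4)) : ℕ) from rfl,
    sum_graphCartan_eq β ⟨k, by omega⟩ (fun j => (if j = k then 2 * extend β j else 0) -
      (if j = s then extend β j else 0) - (if j + 1 = k then extend β j else 0)),
    Finset.sum_sub_distrib, Finset.sum_sub_distrib, Finset.sum_ite_eq', Finset.sum_ite_eq',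
    if_pos (Finset.mem_range.mpr (by omega)), if_pos (Finset.mem_range.mpr (by omega))]
  · have h1 : legSequence β (k + 1) = extend β s := by
      unfold legSequence
      rcases hk.eq_or_lt with h | h
      · rw [if_neg (by omega), if_pos (by omega), hs' h]
      · rw [if_pos (by omega), hs h]
    have h2 : legSequence β k = extend β k := by rw [legSequence, if_pos hk]
    clear hs hs'
    cases k with
    | zero => simp [increment, h1, h2]; ring
    | succ k =>
      have h3 : legSequence β k = extend β k := by rw [legSequence, if_pos (by omega)]
      simp only [Nat.add_right_cancel_iff]
      rw [Finset.sum_ite_eq', if_pos (Finset.mem_range.mpr (by omega))]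
      simp only [increment]
      rw [h1, h2, h3]; ring
  · intro j
    have := j.2
    simp only [graphCartan, graphD_adj, extend_val, Fin.ext_iff]
    split_ifs <;> omega

lemma pairingD_branch (β : Fin (m + 4) → ℤ) :
    pairingD β (m + 3) =
      increment (legSequence β) (m + 1) - increment (legSequence β) (m + 2) := by
  rw [show m + 3 = ((⟨m + 3, by omega⟩ : Fin (m + 4)) : ℕ) from rfl,
    sum_graphCartan_eq β ⟨m + 3, by omega⟩ (fun j => (if j = m + 3 then 2 * extend β j else 0) -
      (if j = m then extend β j else 0) - (if j = m + 1 then extend β j else 0) -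
      (if j = m + 2 then extend β j else 0)),
    Finset.sum_sub_distrib, Finset.sum_sub_distrib, Finset.sum_sub_distrib]
  · simp [increment, legSequence]; ring
  · intro j
    have := j.2
    simp only [graphCartan, graphD_adj, extend_val, Fin.ext_iff, true_and]
    split_ifs <;> omega

lemma pairingD_short (β : Fin (m + 4) → ℤ) {k : ℕ} (hk : k = m + 1 ∨ k = m + 2) :
    pairingD β k = 2 * extend β k - extend β (m + 3) := by
  rw [show k = ((⟨k, by omega⟩ : Fin (m + 4)) : ℕ) from rfl,
    sum_graphCartan_eq β ⟨k, by omega⟩ (fun j => (if j = k then 2 * extend β j else 0) -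
      (if j = m + 3 then extend β j else 0)),
    Finset.sum_sub_distrib, Finset.sum_ite_eq', Finset.sum_ite_eq',
    if_pos (Finset.mem_range.mpr (by omega)), if_pos (Finset.mem_range.mpr (by omega))]
  intro j
  have := j.2
  simp only [graphCartan, graphD_adj, extend_val, Fin.ext_iff]
  rcases hk with rfl | rfl <;> split_ifs <;> omega

/-- With `c` at the branch vertex and `x`, `y` at the short legs, the point is `2x² + 2y² - 2c(x +
y) + c² = (x + y - c)² + (x - y)²`. -/
lemma cartanNorm_graphD (β : Fin (m + 4) → ℤ) :
    cartanNorm (graphCartan (graphD (m + 4))) β =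
      energy (legSequence β) (m + 2) + (extend β (m + 1) - extend β (m + 2)) ^ 2 := by
  have h : cartanNorm (graphCartan (graphD (m + 4))) β =
      ∑ k ∈ Finset.range (m + 4), extend β k * pairingD β k := by
    rw [← Fin.sum_univ_eq_sum_range (fun k => extend β k * pairingD β k)]
    rw [cartanNorm, dotProduct]
    exact Finset.sum_congr rfl fun i _ => by rw [extend_val, pairingD, extend_val]
  have h1 : ∑ k ∈ Finset.range (m + 1), extend β k * pairingD β k =
      ∑ k ∈ Finset.range (m + 1), legSequence β k *
        (increment (legSequence β) k - increment (legSequence β) (k + 1)) := by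
    refine Finset.sum_congr rfl fun k hk => ?_
    have hk' : k ≤ m := by have := Finset.mem_range.mp hk; omega
    rw [pairingD_leg β hk', legSequence, if_pos hk']
  rw [h, Finset.sum_range_succ, Finset.sum_range_succ, Finset.sum_range_succ, h1,
    sum_mul_increment, pairingD_branch, pairingD_short β (Or.inl rfl),
    pairingD_short β (Or.inr rfl), energy_succ, energy_succ]
  simp only [increment]
  simp [legSequence]
  ring

lemma isSweepable_graphD : IsSweepable (graphCartan (graphD (m + 4))) := by
  have hpair : ∀ (β : Fin (m + 4) → ℤ) (v : Fin (m + 4)),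
      (graphCartan (graphD (m + 4)) *ᵥ β) v = pairingD β v := fun β v => by
    rw [pairingD, extend_val]
  -- An ascent lies on the long leg, where the increments of `β` are `0` and `1`.
  have key : ∀ β, 0 ≤ β → cartanNorm (graphCartan (graphD (m + 4))) β = 2 →
      ∀ v, IsAscent (graphCartan (graphD (m + 4))) β v →
      ∃ k, k ≤ m + 1 ∧ (v : ℕ) = (if k ≤ m then k else m + 3) ∧ energy (legSequence β) k = 1 ∧
        energy (legSequence β) (k + 1) = 2 ∧ legSequence β k = 1 ∧ legSequence β (k + 1) = 2 := by
    rintro β h0 h2 v ⟨hv, hv'⟩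
    rw [cartanNorm_graphD] at h2
    rw [hpair] at hv'
    rw [← extend_val β] at hv
    have h0e : ∀ i, 0 ≤ extend β i := by
      intro i; unfold extend; split_ifs
      · exact h0 _
      · exact le_rfl
    have h0' : ∀ i, 0 ≤ legSequence β i := by
      intro i
      have := h0e i
      have := h0e (m + 3)
      have := h0e (m + 2)
      have := h0e (m + 1)
      unfold legSequence; split_ifs <;> omega
    have hsq := sq_nonneg (extend β (m + 1) - extend β (m + 2))
    have hE : ∀ k ≤ m + 1, energy (legSequence β) (k + 1) ≤ 2 := fun k hk => by
      have := energy_mono (legSequence β) (show k + 1 ≤ m + 2 by omega)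
      omega
    have hc := le_energy (legSequence β) (m + 1)
    have hc2 := energy_mono (legSequence β) (show m + 1 ≤ m + 2 by omega)
    have hcv : legSequence β (m + 1) = extend β (m + 3) := by simp [legSequence]
    have hvn := v.2
    rcases (by omega : (v : ℕ) ≤ m ∨ (v : ℕ) = m + 3 ∨ ((v : ℕ) = m + 1 ∨ (v : ℕ) = m + 2)) with
      h | h | h
    · rw [pairingD_leg β h] at hv'
      have hl : legSequence β v = extend β v := by rw [legSequence, if_pos h]
      exact ⟨v, by omega, by rw [if_pos h],
        increment_of_ascent (fun i _ => h0' i) (by omega) hv' (hE _ (by omega))⟩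
    · rw [h, pairingD_branch] at hv'
      rw [h] at hv
      exact ⟨m + 1, le_rfl, by rw [if_neg (by omega), h],
        increment_of_ascent (fun i _ => h0' i) (by omega) hv' (hE _ (by omega))⟩
    -- An ascent at a short leg would need a coefficient of at least `3` at the branch vertex, which
    -- the energy bounds by `2`.
    · rw [pairingD_short β h] at hv'
      omega
  refine ⟨fun i j => ?_, fun i => ?_, fun i j hij => ?_, fun β => ?_, fun β hβ => ?_,
    fun β h0 h2 v hv => ?_, fun β h0 h2 v w hv hw => ?_⟩
  · simp only [graphCartan, eq_comm (a := i), SimpleGraph.adj_comm _ i]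
  · simp [graphCartan]
  · simp only [graphCartan, if_neg hij]; split_ifs <;> simp
  · rw [cartanNorm_graphD]
    exact add_nonneg (energy_nonneg _ _) (sq_nonneg _)
  · rw [cartanNorm_graphD] at hβ
    have h1 := energy_nonneg (legSequence β) (m + 2)
    have h2 := sq_nonneg (extend β (m + 1) - extend β (m + 2))
    have h3 : extend β (m + 1) - extend β (m + 2) = 0 :=
      pow_eq_zero_iff (two_ne_zero) |>.mp (by omega)
    have h4 : ∀ k ≤ m + 2, legSequence β k = 0 := fun k hk =>
      eq_zero_of_energy_eq_zero _ hk (by omega)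
    have h5 := h4 (m + 1) (by omega)
    have h6 := h4 (m + 2) le_rfl
    simp only [legSequence] at h5 h6
    simp at h5 h6
    funext i
    rw [← extend_val β]
    have hi := i.2
    rcases (by omega : (i : ℕ) ≤ m ∨ (i : ℕ) = m + 3 ∨ (i : ℕ) = m + 1 ∨ (i : ℕ) = m + 2) with
      h | h | h | h
    · have := h4 i (by omega)
      rwa [legSequence, if_pos h] at this
    all_goals rw [h]; simp only [Pi.zero_apply]; omega
  · obtain ⟨k, hk, hvk, hE1, hE2, hB1, hB2⟩ := key β h0 h2 v hv
    rw [cartanNorm_graphD] at h2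
    have hsq := sq_nonneg (extend β (m + 1) - extend β (m + 2))
    have hmono := energy_mono (legSequence β) (show k + 1 ≤ m + 2 by omega)
    have h3 : extend β (m + 1) - extend β (m + 2) = 0 :=
      pow_eq_zero_iff (two_ne_zero) |>.mp (by omega)
    have hadj : ∀ w : Fin (m + 4), (graphD (m + 4)).Adj v w →
        graphCartan (graphD (m + 4)) v w = -1 := fun w hw => by
      rw [graphCartan, if_neg hw.ne, if_pos hw]
    -- The energy is used up at `k + 1`, so the sequence stays at `2` from there on, and the vertex
    -- after the ascent has pairing `1 - 0`.
    have hinc : k ≤ m → increment (legSequence β) (k + 1) = 1 ∧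
        increment (legSequence β) (k + 1 + 1) = 0 := by
      intro hk'
      have h4 := energy_succ (legSequence β) (k + 1)
      have h5 := energy_mono (legSequence β) (show k + 1 + 1 ≤ m + 2 by omega)
      have h6 := sq_nonneg (legSequence β (k + 1 + 1) - legSequence β (k + 1))
      refine ⟨by simp only [increment]; omega, ?_⟩
      exact pow_eq_zero_iff (two_ne_zero) |>.mp (by simp only [increment]; omega)
    rcases (by omega : k < m ∨ k = m ∨ k = m + 1) with h | h | h
    · rw [if_pos h.le] at hvk
      refine ⟨⟨k + 1, by omega⟩, hadj _ ((graphD_adj _ _).mpr (by simp only; omega)), ?_⟩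
      rw [hpair, pairingD_leg β (by simp only; omega)]
      have := hinc h.le
      rw [← hvk] at this
      simp only
      omega
    · rw [if_pos h.le] at hvk
      refine ⟨⟨m + 3, by omega⟩, hadj _ ((graphD_adj _ _).mpr (by simp only [true_and]; omega)), ?_⟩
      rw [hpair, pairingD_branch β]
      have := hinc h.le
      rw [h] at this
      rw [this.1, show m + 2 = m + 1 + 1 from rfl, this.2, sub_zero]
    -- The ascent is the branch vertex, with coefficient `1`; both short legs have coefficient `1`,
    -- hence pairing `2 - 1`, and either would do.
    · rw [if_neg (by omega)] at hvk
      refine ⟨⟨m + 1, by omega⟩, hadj _ ((graphD_adj _ _).mpr (by simp only; omega)), ?_⟩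
      rw [hpair, pairingD_short β (Or.inl rfl)]
      rw [h] at hB1 hB2
      simp only [legSequence] at hB1 hB2
      simp at hB1 hB2
      omega
  · obtain ⟨k, hk, hvk, hE1, hE2, -⟩ := key β h0 h2 v hv
    obtain ⟨l, hl, hwl, hF1, hF2, -⟩ := key β h0 h2 w hw
    -- The energy is monotone, so it goes from `1` to `2` at one index only.
    have hkl : k = l := by
      rcases lt_trichotomy k l with h | h | h
      · have := energy_mono (legSequence β) (show k + 1 ≤ l from h); omega
      · exact h
      · have := energy_mono (legSequence β) (show l + 1 ≤ k from h); omega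
    subst hkl
    exact Fin.ext (hvk.trans hwl.symm)

lemma isSweepable_cartanMatrix {Q : Quiver.{v} (Fin n)} (hQ : IsTypeA Q ∨ IsTypeD Q) :
    IsSweepable (cartanMatrix Q) := by
  rcases hQ with ⟨-, e, he⟩ | ⟨hn, e, he⟩
  · exact isSweepable_path.of_equiv e (cartanMatrix_eq_graphCartan e he)
  · obtain ⟨m, rfl⟩ := Nat.exists_eq_add_of_le' hn
    exact isSweepable_graphD.of_equiv e (cartanMatrix_eq_graphCartan e he)

end CartanTypes

/-! ### Spiral curves -/

section Spiral

variable {n : ℕ}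

/-- The square of a polynomial interpolating the square roots is automatically nonnegative. -/
lemma exists_smooth_interpolation (v : Fin n → ℝ) (hv : ∀ k, 0 ≤ v k) :
    ∃ g : ℝ → ℝ, ContDiff ℝ ∞ g ∧ g 0 = 0 ∧ (∀ x, 0 ≤ g x) ∧
      ∀ k : Fin n, g ((k : ℝ) + 1) = v k := by
  let node : Fin (n + 1) → ℝ := fun i => (i : ℝ)
  let val : Fin (n + 1) → ℝ := Fin.cons 0 fun k => Real.sqrt (v k)
  have hinj : Set.InjOn node ((Finset.univ : Finset (Fin (n + 1))) : Set (Fin (n + 1))) := by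
    intro i _ j _ hij
    have hij' : (i : ℝ) = j := hij
    exact Fin.ext (by exact_mod_cast hij')
  have heval : ∀ i, (Lagrange.interpolate Finset.univ node val).eval (node i) = val i := fun i =>
    Lagrange.eval_interpolate_at_node val hinj (Finset.mem_univ i)
  set q := Lagrange.interpolate Finset.univ node val
  refine ⟨fun x => (q.eval x) ^ 2, ?_, ?_, fun x => sq_nonneg _, fun k => ?_⟩
  · simpa using (Polynomial.contDiff_aeval q ∞ (𝕜 := ℝ)).pow 2
  · have h := heval 0
    rw [show node 0 = 0 by simp [node], show val 0 = 0 from rfl] at h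
    simp [h]
  · have h := heval k.succ
    rw [show node k.succ = (k : ℝ) + 1 by simp [node], show val k.succ = √(v k) from rfl] at h
    simp only [h]
    exact Real.sq_sqrt (hv k)

/-- The factor `1` for clockwise and `-1` for anticlockwise spirals. -/
def orient (b : Bool) : ℝ := if b then 1 else -1

lemma orient_mul_self (b : Bool) : orient b * orient b = 1 := by cases b <;> simp [orient]

/-- The horizontal coordinate of the spiral, as a function of the angle travelled backwards
from the end of the curve. -/
noncomputable def spiralX (n : ℕ) (b : Bool) (φ : ℝ) : ℝ :=
  orient b * (Real.sin φ * ((n + 1) + Real.exp (-φ) *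
    Real.smoothTransition (((n + 1) * Real.sin φ) ^ 2 - (n + 1 / 2) ^ 2)))

/-- The vertical coordinate of the spiral. -/
noncomputable def spiralY (φ : ℝ) : ℝ := -(Real.exp (-φ) * Real.cos φ)

lemma contDiff_spiralX (b : Bool) : ContDiff ℝ ∞ (spiralX n b) := by
  have h : ContDiff ℝ ∞ Real.smoothTransition := Real.smoothTransition.contDiff
  have h2 : ContDiff ℝ ∞ fun φ : ℝ => ((n + 1) * Real.sin φ) ^ 2 - ((n : ℝ) + 1 / 2) ^ 2 := by
    fun_prop
  have h3 := h.comp h2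
  unfold spiralX
  exact contDiff_const.mul (Real.contDiff_sin.mul (contDiff_const.add
    ((Real.contDiff_exp.comp contDiff_neg).mul h3)))

lemma contDiff_spiralY : ContDiff ℝ ∞ spiralY := by
  unfold spiralY; fun_prop

/-- Without the transition term in `spiralX`, all turns would pass through the points with `cos φ =
0`, where the height is `0`. The factor `exp (-φ)` makes the later turns narrower there; elsewhere
the heights already tell the turns apart. -/
lemma spiral_injective_aux (b : Bool) {φ ψ : ℝ} (hlt : φ < ψ)
    (hX : spiralX n b φ = spiralX n b ψ) : spiralY φ ≠ spiralY ψ := by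
  intro hY
  have he : Real.exp (-ψ) < Real.exp (-φ) := Real.exp_lt_exp.mpr (by linarith)
  have he' := Real.exp_pos (-ψ)
  have ho : orient b ≠ 0 := by cases b <;> simp [orient]
  have hX' := congrArg (fun x => x ^ 2) (mul_left_cancel₀ ho hX)
  have hY' := congrArg (fun x => x ^ 2) (neg_injective hY)
  simp only [mul_pow] at hX' hY'
  have hs1 := Real.sin_sq_add_cos_sq φ
  have hs2 := Real.sin_sq_add_cos_sq ψ
  generalize Real.exp (-φ) = e at *
  generalize Real.exp (-ψ) = f at *
  -- Otherwise both factors of the squared height would be smaller at `ψ`.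
  have hS : Real.sin ψ ^ 2 ≤ Real.sin φ ^ 2 := by
    by_contra hcon
    have h1 : Real.cos ψ ^ 2 < Real.cos φ ^ 2 := by linarith
    have h2 : f ^ 2 < e ^ 2 := by nlinarith
    have h3 := sq_nonneg (Real.cos ψ)
    nlinarith [mul_pos (sub_pos.mpr h1) (sub_pos.mpr h2), sq_nonneg f, sq_nonneg e]
  generalize Real.cos φ ^ 2 = c at *
  generalize Real.cos ψ ^ 2 = d at *
  generalize Real.sin φ ^ 2 = S at *
  generalize hR : Real.sin ψ ^ 2 = R at *
  have hR0 : 0 ≤ R := hR ▸ sq_nonneg _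
  have hn : (0 : ℝ) < (n : ℝ) + 1 := by positivity
  have hmono : Real.smoothTransition (((n : ℝ) + 1) ^ 2 * R - (n + 1 / 2) ^ 2) ≤
      Real.smoothTransition (((n : ℝ) + 1) ^ 2 * S - (n + 1 / 2) ^ 2) := by
    apply Real.smoothTransition.monotone
    have := mul_le_mul_of_nonneg_left hS (sq_nonneg ((n : ℝ) + 1))
    linarith
  have hT0 := Real.smoothTransition.nonneg (((n : ℝ) + 1) ^ 2 * R - (n + 1 / 2) ^ 2)
  have hbase : (n : ℝ) + 1 + f * Real.smoothTransition (((n : ℝ) + 1) ^ 2 * R - (n + 1 / 2) ^ 2) ≤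
      (n : ℝ) + 1 + e * Real.smoothTransition (((n : ℝ) + 1) ^ 2 * S - (n + 1 / 2) ^ 2) := by
    have := mul_le_mul he.le hmono hT0 (he'.trans he).le
    linarith
  have hpos : 0 < (n : ℝ) + 1 +
      f * Real.smoothTransition (((n : ℝ) + 1) ^ 2 * R - (n + 1 / 2) ^ 2) := by positivity
  have hsq := pow_le_pow_left₀ hpos.le hbase 2
  have hRS : R = S := by
    refine le_antisymm hS (le_of_not_gt fun hlt' => ?_)
    have h1 := mul_lt_mul_of_pos_right hlt' (pow_pos hpos 2)
    have h2 := mul_le_mul_of_nonneg_left hsq (hR0.trans hS)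
    linarith
  subst hRS
  have hcd : c = d := by linarith
  subst hcd
  have hc : c = 0 := by
    have h1 : (e - f) * (e + f) * c = 0 := by linarith
    have h2 : (e - f) * (e + f) ≠ 0 := mul_ne_zero (by linarith) (by linarith)
    exact (mul_eq_zero.mp h1).resolve_left h2
  have hS1 : R = 1 := by linarith
  rw [hS1] at hX' hpos hbase
  have hT : 0 < Real.smoothTransition (((n : ℝ) + 1) ^ 2 * 1 - (n + 1 / 2) ^ 2) := by
    apply Real.smoothTransition.pos_of_pos
    have : (0 : ℝ) ≤ n := n.cast_nonneg
    nlinarith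
  generalize Real.smoothTransition (((n : ℝ) + 1) ^ 2 * 1 - (n + 1 / 2) ^ 2) = T at *
  rw [one_mul, one_mul] at hX'
  have h1 := (pow_left_inj₀ (hpos.le.trans hbase) hpos.le two_ne_zero).mp hX'
  have h2 := mul_lt_mul_of_pos_right he hT
  linarith

lemma spiral_injective (b : Bool) {φ ψ : ℝ} (hX : spiralX n b φ = spiralX n b ψ)
    (hY : spiralY φ = spiralY ψ) : φ = ψ := by
  rcases lt_trichotomy φ ψ with h | h | h
  · exact absurd hY (spiral_injective_aux b h hX)
  · exact h
  · exact absurd hY.symm (spiral_injective_aux b h hX.symm)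

lemma smoothTransition_eq_zero_of_abs_le {x : ℝ} (hx : |x| ≤ n + 1 / 2) :
    Real.smoothTransition (x ^ 2 - (n + 1 / 2) ^ 2) = 0 := by
  apply Real.smoothTransition.zero_of_nonpos
  have := sq_le_sq' (by linarith [neg_abs_le x]) ((le_abs_self x).trans hx)
  linarith

/-- The abscissae of the marked points are at most `n`, where the transition term vanishes, so the
angles of passage are given by a plain arcsine on every turn. -/
lemma spiralX_eq_iff (b : Bool) (φ : ℝ) (k : Fin n) :
    spiralX n b φ = (k : ℝ) + 1 ↔ orient b * Real.sin φ = ((k : ℝ) + 1) / (n + 1) := by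
  have hk : (k : ℝ) + 1 ≤ n := by exact_mod_cast k.2
  have hk0 : (0 : ℝ) ≤ k := Nat.cast_nonneg _
  have hn : (0 : ℝ) < (n : ℝ) + 1 := by positivity
  have hX : spiralX n b φ = orient b * Real.sin φ * ((n + 1) + Real.exp (-φ) *
      Real.smoothTransition (((n + 1) * (orient b * Real.sin φ)) ^ 2 - (n + 1 / 2) ^ 2)) := by
    have : ((n + 1) * (orient b * Real.sin φ)) ^ 2 = ((n + 1) * Real.sin φ) ^ 2 := by
      linear_combination ((n + 1) * Real.sin φ) ^ 2 * orient_mul_self b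
    rw [this, spiralX]; ring
  rw [hX, eq_div_iff hn.ne']
  generalize orient b * Real.sin φ = σ
  constructor
  · intro h
    have hT := Real.smoothTransition.nonneg (((n + 1) * σ) ^ 2 - ((n : ℝ) + 1 / 2) ^ 2)
    have hF : 0 ≤ Real.exp (-φ) *
        Real.smoothTransition (((n + 1) * σ) ^ 2 - ((n : ℝ) + 1 / 2) ^ 2) := by positivity
    have hσ : 0 < σ := by
      by_contra hcon
      have := mul_nonpos_of_nonpos_of_nonneg (not_lt.mp hcon) (add_nonneg hn.le hF)
      linarith
    have h1 := mul_nonneg hσ.le hF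
    rw [smoothTransition_eq_zero_of_abs_le] at h
    · linarith
    · rw [abs_of_pos (mul_pos hn hσ)]
      nlinarith
  · intro h
    rw [smoothTransition_eq_zero_of_abs_le]
    · linarith
    · rw [mul_comm, h, abs_of_pos (by linarith)]; linarith

lemma deriv_spiralX_ne_zero (b : Bool) {φ : ℝ} {k : Fin n}
    (hX : spiralX n b φ = (k : ℝ) + 1) (hY : 0 < spiralY φ) : deriv (spiralX n b) φ ≠ 0 := by
  rw [spiralX_eq_iff] at hX
  have hk : (k : ℝ) + 1 ≤ n := by exact_mod_cast k.2
  have hk0 : (0 : ℝ) ≤ k := Nat.cast_nonneg _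
  have hn : (0 : ℝ) < (n : ℝ) + 1 := by positivity
  have hsin : ((n + 1) * Real.sin φ) ^ 2 < ((n : ℝ) + 1 / 2) ^ 2 := by
    have h1 : ((n + 1) * Real.sin φ) ^ 2 = ((k : ℝ) + 1) ^ 2 := by
      rw [eq_div_iff hn.ne'] at hX
      rw [← hX]
      linear_combination -((n + 1) * Real.sin φ) ^ 2 * orient_mul_self b
    rw [h1]
    nlinarith
  have hev : spiralX n b =ᶠ[nhds φ] fun ψ => orient b * (Real.sin ψ * (n + 1)) := by
    have hcont : Continuous fun ψ : ℝ => ((n + 1) * Real.sin ψ) ^ 2 := by fun_prop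
    filter_upwards [hcont.continuousAt.eventually_lt_const hsin] with ψ hψ
    rw [spiralX, Real.smoothTransition.zero_of_nonpos (by linarith), mul_zero, add_zero]
  rw [hev.deriv_eq, (((Real.hasDerivAt_sin φ).mul_const _).const_mul _).deriv]
  have hc : Real.cos φ ≠ 0 := by
    intro h
    rw [spiralY, h] at hY
    simp at hY
  have ho : orient b ≠ 0 := by cases b <;> simp [orient]
  exact mul_ne_zero ho (mul_ne_zero hc hn.ne')

lemma neg_one_le_spiralY {φ : ℝ} (hφ : 0 ≤ φ) : -1 ≤ spiralY φ := by
  have h1 : Real.exp (-φ) ≤ 1 := Real.exp_le_one_iff.mpr (by linarith)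
  have h2 := Real.exp_pos (-φ)
  have h3 := Real.cos_le_one φ
  unfold spiralY
  nlinarith

lemma spiralY_le_one {φ : ℝ} (hφ : 0 ≤ φ) : spiralY φ ≤ 1 := by
  have h1 : Real.exp (-φ) ≤ 1 := Real.exp_le_one_iff.mpr (by linarith)
  have h2 := Real.exp_pos (-φ)
  have h3 := Real.neg_one_le_cos φ
  unfold spiralY
  nlinarith

/-- The `u`-th index of the cyclic sequence `n - 1, …, 0, n - 1, …, 0, …` or
`0, …, n - 1, 0, …, n - 1, …`. -/
def visit (hn : 0 < n) (b : Bool) (u : ℕ) : Fin n :=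
  if b then ⟨n - 1 - u % n, by omega⟩ else ⟨u % n, Nat.mod_lt _ hn⟩

lemma visit_add (hn : 0 < n) (b : Bool) (u : ℕ) : visit hn b (u + n) = visit hn b u := by
  simp [visit]

lemma visit_eq_visit_iff (hn : 0 < n) (b : Bool) (u w : ℕ) :
    visit hn b u = visit hn b w ↔ u % n = w % n := by
  have := Nat.mod_lt u hn
  have := Nat.mod_lt w hn
  cases b
  · simp [visit]
  · simp [visit]; omega

/-- The angle at which the spiral is above the marked point `visit hn b u` for the `u`-th time. -/
noncomputable def eventAngle (hn : 0 < n) (b : Bool) (u : ℕ) : ℝ :=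
  Real.pi - orient b * Real.arcsin (((visit hn b u : ℕ) + 1 : ℝ) / (n + 1)) +
    (u / n : ℕ) * (2 * Real.pi)

lemma eventAngle_add (hn : 0 < n) (b : Bool) (u : ℕ) :
    eventAngle hn b (u + n) = eventAngle hn b u + 2 * Real.pi := by
  rw [eventAngle, eventAngle, visit_add, Nat.add_div_right _ hn]
  push_cast
  ring

lemma ratio_mem (k : Fin n) : 0 < ((k : ℝ) + 1) / (n + 1) ∧ ((k : ℝ) + 1) / (n + 1) < 1 := by
  have hk : (k : ℝ) + 1 ≤ n := by exact_mod_cast k.2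
  have hk0 : (0 : ℝ) ≤ k := Nat.cast_nonneg _
  have hn : (0 : ℝ) < (n : ℝ) + 1 := by positivity
  exact ⟨by positivity, by rw [div_lt_one hn]; linarith⟩

lemma sin_eventAngle (hn : 0 < n) (b : Bool) (u : ℕ) :
    orient b * Real.sin (eventAngle hn b u) = ((visit hn b u : ℕ) + 1 : ℝ) / (n + 1) := by
  obtain ⟨h1, h2⟩ := ratio_mem (visit hn b u)
  rw [eventAngle, Real.sin_add_nat_mul_two_pi, Real.sin_pi_sub]
  have h := Real.sin_arcsin (by linarith) h2.le
  cases b <;> simpa [orient] using h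

lemma cos_eventAngle_neg (hn : 0 < n) (b : Bool) (u : ℕ) :
    Real.cos (eventAngle hn b u) < 0 := by
  obtain ⟨h1, h2⟩ := ratio_mem (visit hn b u)
  rw [eventAngle, Real.cos_add_nat_mul_two_pi, Real.cos_pi_sub, neg_lt_zero]
  have h : 0 < Real.cos (Real.arcsin (((visit hn b u : ℕ) + 1 : ℝ) / (n + 1))) := by
    rw [Real.cos_arcsin]
    apply Real.sqrt_pos.mpr
    nlinarith
  cases b <;> simpa [orient] using h

/-- Modulo `2π` the angle lies in `(π/2, 3π/2)`, where the sine is injective; the number of full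
turns fixes the remaining part of `u`. -/
lemma exists_eventAngle_eq (hn : 0 < n) (b : Bool) {φ : ℝ} (hφ : 0 ≤ φ) (hc : Real.cos φ < 0)
    {k : Fin n} (hs : orient b * Real.sin φ = ((k : ℝ) + 1) / (n + 1)) :
    ∃ u, visit hn b u = k ∧ φ = eventAngle hn b u := by
  have hpi := Real.pi_pos
  have hs' : Real.sin φ = orient b * (((k : ℝ) + 1) / (n + 1)) := by
    rw [← hs, ← mul_assoc, orient_mul_self, one_mul]
  obtain ⟨r, hr, hrk⟩ : ∃ r < n, ∀ m : ℕ, visit hn b (r + n * m) = k := by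
    cases b
    · exact ⟨k, k.2, fun m => by
        ext; simp [visit, Nat.add_mul_mod_self_left, Nat.mod_eq_of_lt k.2]⟩
    · refine ⟨n - 1 - k, by omega, fun m => ?_⟩
      ext
      simp [visit, Nat.add_mul_mod_self_left, Nat.mod_eq_of_lt (show n - 1 - k < n by omega)]
      omega
  set m := ⌊φ / (2 * Real.pi)⌋₊ with hm
  set ψ := φ - m * (2 * Real.pi) with hψ
  have hψ0 : 0 ≤ ψ := by
    have := Nat.floor_le (div_nonneg hφ (by positivity : (0 : ℝ) ≤ 2 * Real.pi))
    rw [le_div_iff₀ (by positivity)] at this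
    linarith
  have hψ1 : ψ < 2 * Real.pi := by
    have := Nat.lt_floor_add_one (φ / (2 * Real.pi))
    rw [div_lt_iff₀ (by positivity)] at this
    linarith
  have hcψ : Real.cos ψ < 0 := by rwa [hψ, Real.cos_sub_nat_mul_two_pi]
  have hsψ : Real.sin ψ = orient b * (((k : ℝ) + 1) / (n + 1)) := by
    rw [hψ, Real.sin_sub_nat_mul_two_pi, hs']
  have h1 : Real.pi / 2 < ψ := by
    by_contra hcon
    have := Real.cos_nonneg_of_neg_pi_div_two_le_of_le (x := ψ) (by linarith) (not_lt.mp hcon)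
    linarith
  have h2 : ψ < 3 * Real.pi / 2 := by
    by_contra hcon
    have := Real.cos_nonneg_of_neg_pi_div_two_le_of_le (x := ψ - 2 * Real.pi) (by linarith)
      (by linarith)
    rw [Real.cos_sub_two_pi] at this
    linarith
  have h3 : Real.arcsin (orient b * (((k : ℝ) + 1) / (n + 1))) = Real.pi - ψ := by
    rw [← hsψ, ← Real.sin_pi_sub, Real.arcsin_sin (by linarith) (by linarith)]
  have h4 : Real.arcsin (orient b * (((k : ℝ) + 1) / (n + 1))) =
      orient b * Real.arcsin (((k : ℝ) + 1) / (n + 1)) := by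
    cases b
    · simp only [orient, Bool.false_eq_true, if_false, neg_mul, one_mul, Real.arcsin_neg]
    · simp [orient]
  refine ⟨r + n * m, hrk m, ?_⟩
  rw [eventAngle, hrk m, Nat.add_mul_div_left _ _ hn, Nat.div_eq_of_lt hr, zero_add]
  linarith

lemma strictMono_eventAngle (hn : 0 < n) (b : Bool) : StrictMono (eventAngle hn b) := by
  have hpi := Real.pi_pos
  have hn' : (0 : ℝ) < (n : ℝ) + 1 := by positivity
  have hbound : ∀ u, |orient b * Real.arcsin (((visit hn b u : ℕ) + 1 : ℝ) / (n + 1))| ≤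
      Real.pi / 2 := by
    intro u
    have h1 := Real.arcsin_le_pi_div_two (((visit hn b u : ℕ) + 1 : ℝ) / (n + 1))
    have h2 := Real.neg_pi_div_two_le_arcsin (((visit hn b u : ℕ) + 1 : ℝ) / (n + 1))
    rw [abs_le]
    cases b
    · simp only [orient, Bool.false_eq_true, if_false, neg_mul, one_mul]
      constructor <;> linarith
    · simp only [orient, if_true, one_mul]
      constructor <;> linarith
  intro u w huw
  rcases (Nat.div_le_div_right (c := n) huw.le).eq_or_lt with hq | hq
  · have hmod : u % n < w % n := by
      have h1 := Nat.div_add_mod u n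
      have h2 := Nat.div_add_mod w n
      rw [hq] at h1
      omega
    have hmw := Nat.mod_lt w hn
    rw [eventAngle, eventAngle, hq]
    have hlt : ∀ i j : Fin n, i < j → Real.arcsin (((i : ℕ) + 1 : ℝ) / (n + 1)) <
        Real.arcsin (((j : ℕ) + 1 : ℝ) / (n + 1)) := by
      intro i j hij
      apply Real.arcsin_lt_arcsin
      · linarith [(ratio_mem i).1]
      · have : (i : ℝ) < j := by exact_mod_cast hij
        exact div_lt_div_of_pos_right (by linarith) hn'
      · exact (ratio_mem j).2.le
    cases b
    · have := hlt (visit hn false u) (visit hn false w) (by simp [visit, hmod])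
      simp only [orient, Bool.false_eq_true, if_false, neg_mul, one_mul]
      linarith
    · have := hlt (visit hn true w) (visit hn true u) (by simp [visit]; omega)
      simp only [orient, if_true, one_mul]
      linarith
  · have h1 := abs_le.mp (hbound u)
    have h2 := abs_le.mp (hbound w)
    have h3 : ((u / n : ℕ) : ℝ) + 1 ≤ ((w / n : ℕ) : ℝ) := by exact_mod_cast hq
    rw [eventAngle, eventAngle]
    nlinarith [mul_le_mul_of_nonneg_right h3 (by linarith : (0 : ℝ) ≤ 2 * Real.pi)]

end Spiral

/-! ### Admissible spirals with prescribed crossings. -/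

section SpiralCurve

variable {n : ℕ}

lemma exists_visit_eq (hn : 0 < n) (b : Bool) (u : ℕ) (k : Fin n) :
    ∃ x, u ≤ x ∧ x < u + n ∧ visit hn b x = k := by
  obtain ⟨r, hr, hrk⟩ : ∃ r < n, visit hn b r = k := by
    cases b
    · exact ⟨k, k.2, by ext; simp [visit, Nat.mod_eq_of_lt k.2]⟩
    · refine ⟨n - 1 - k, by omega, ?_⟩
      ext
      simp [visit, Nat.mod_eq_of_lt (show n - 1 - k < n by omega)]
      omega
  have h1 := Nat.div_add_mod u n
  have h2 := Nat.mod_lt u hn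
  by_cases h : u % n ≤ r
  · refine ⟨n * (u / n) + r, by omega, by omega, ?_⟩
    rw [← hrk, visit_eq_visit_iff, Nat.mul_add_mod]
  · refine ⟨n * (u / n) + r + n, by omega, by omega, ?_⟩
    rw [visit_add, ← hrk, visit_eq_visit_iff, Nat.mul_add_mod]

lemma isCyclic_visit (hn : 0 < n) (b : Bool) (e : Equiv.Perm (Fin n)) :
    IsCyclic fun u => e (visit hn b u) := by
  refine ⟨fun u v => ?_, fun x y hxy hyx h => ?_⟩
  · obtain ⟨x, h1, h2, h3⟩ := exists_visit_eq hn b u (e.symm v)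
    exact ⟨x, h1, h2, by simp [h3]⟩
  · have h1 := (visit_eq_visit_iff hn b x y).mp (e.injective h)
    have h2 : n ∣ y - x := (Nat.modEq_iff_dvd' hxy.le).mp h1
    have := Nat.le_of_dvd (by omega) h2
    omega

lemma eventAngle_pos (hn : 0 < n) (b : Bool) (u : ℕ) : 0 < eventAngle hn b u := by
  have h0 : 0 ≤ eventAngle hn b 0 := by
    have h1 := Real.arcsin_le_pi_div_two (((visit hn b 0 : ℕ) + 1 : ℝ) / (n + 1))
    have h2 := Real.arcsin_nonneg.mpr (ratio_mem (visit hn b 0)).1.le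
    have hpi := Real.pi_pos
    rw [eventAngle, Nat.zero_div, Nat.cast_zero, zero_mul, add_zero]
    cases b
    · simp only [orient, Bool.false_eq_true, if_false, neg_mul, one_mul]; linarith
    · simp only [orient, if_true, one_mul]; linarith
  rcases h0.eq_or_lt with h | h
  · have := cos_eventAngle_neg hn b 0
    rw [← h, Real.cos_zero] at this
    linarith
  · exact h.trans_le ((strictMono_eventAngle hn b).monotone (Nat.zero_le u))

lemma spiralY_eventAngle_pos (hn : 0 < n) (b : Bool) (u : ℕ) :
    0 < spiralY (eventAngle hn b u) := by
  rw [spiralY, neg_pos]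
  exact mul_neg_of_pos_of_neg (Real.exp_pos _) (cos_eventAngle_neg hn b u)

/-- The heights of the spiral above a marked point decrease by a factor `exp (2 π)` at least. -/
lemma spiralY_eventAngle_le (hn : 0 < n) (b : Bool) {u w : ℕ} (huw : u < w)
    (hv : visit hn b u = visit hn b w) :
    Real.exp (2 * Real.pi) * spiralY (eventAngle hn b w) ≤ spiralY (eventAngle hn b u) := by
  have hdvd : n ∣ w - u := (Nat.modEq_iff_dvd' huw.le).mp ((visit_eq_visit_iff hn b u w).mp hv)
  obtain ⟨j, hj⟩ := hdvd
  have hj0 : j ≠ 0 := by rintro rfl; omega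
  obtain ⟨i, rfl⟩ : ∃ i, j = i + 1 := ⟨j - 1, by omega⟩
  have hw : w = u + n * (i + 1) := by omega
  subst hw
  clear hj huw hv hj0
  have hstep : ∀ w, spiralY (eventAngle hn b w) =
      Real.exp (2 * Real.pi) * spiralY (eventAngle hn b (w + n)) := by
    intro w
    rw [eventAngle_add, spiralY, spiralY, Real.cos_add_two_pi, neg_add, Real.exp_add]
    have : Real.exp (2 * Real.pi) * Real.exp (-(2 * Real.pi)) = 1 := by
      rw [← Real.exp_add]; simp
    linear_combination (Real.exp (-eventAngle hn b w) * Real.cos (eventAngle hn b w)) * this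
  induction i with
  | zero => rw [hstep u]; simp
  | succ i ih =>
    have h1 := hstep (u + n * (i + 1))
    have h2 : 1 ≤ Real.exp (2 * Real.pi) := Real.one_le_exp (by positivity)
    have h3 := spiralY_eventAngle_pos hn b (u + n * (i + 1))
    rw [show u + n * (i + 1 + 1) = u + n * (i + 1) + n by ring, ← h1]
    nlinarith

/-- The marked points can be put at heights such that the spiral passes above them exactly at
prescribed moments, if at each marked point these moments form an initial segment. -/
lemma exists_heights (hn : 0 < n) (b : Bool) (U : ℕ) (cross : ℕ → Prop)
    (hstart : ∀ u < U, visit hn b u = visit hn b U → cross u)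
    (hdown : ∀ u, u + n < U → cross (u + n) → cross u) :
    ∃ y : Fin n → ℝ, (∀ k, 0 < y k ∧ y k ≤ Real.exp Real.pi) ∧
      y (visit hn b U) = spiralY (eventAngle hn b U) ∧
      ∀ u < U, (cross u → y (visit hn b u) < spiralY (eventAngle hn b u)) ∧
        (¬ cross u → spiralY (eventAngle hn b u) < y (visit hn b u)) := by
  classical
  have hexp : 1 < Real.exp Real.pi := Real.one_lt_exp_iff.mpr Real.pi_pos
  have hexp2 : Real.exp (2 * Real.pi) = Real.exp Real.pi * Real.exp Real.pi := by
    rw [← Real.exp_add]; ring_nf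
  have hlt : ∀ u w, u < w → visit hn b u = visit hn b w →
      Real.exp Real.pi * spiralY (eventAngle hn b w) < spiralY (eventAngle hn b u) := by
    intro u w huw hv
    have h1 := spiralY_eventAngle_le hn b huw hv
    have h2 := spiralY_eventAngle_pos hn b w
    rw [hexp2, mul_assoc] at h1
    nlinarith [mul_pos (Real.exp_pos Real.pi) h2]
  -- Events from `U` on count as uncrossed, so every marked point has a first uncrossed event.
  have hex : ∀ k, ∃ u, visit hn b u = k ∧ ¬ (u < U ∧ cross u) := by
    intro k
    obtain ⟨x, hx, -, hk⟩ := exists_visit_eq hn b U k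
    exact ⟨x, hk, fun h => by omega⟩
  -- The factor `exp π` puts the point strictly between the first uncrossed passage and the previous
  -- one, which is at least `exp (2π)` times as high. The starting point lies on the spiral itself.
  refine ⟨fun k => if k = visit hn b U then spiralY (eventAngle hn b U) else
    Real.exp Real.pi * spiralY (eventAngle hn b (Nat.find (hex k))), fun k => ?_, by simp,
    fun u hu => ?_⟩
  · have h1 := fun w => spiralY_eventAngle_pos hn b w
    have h2 := fun w => spiralY_le_one (eventAngle_pos hn b w).le
    dsimp only
    split_ifs
    · exact ⟨h1 U, (h2 U).trans hexp.le⟩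
    · exact ⟨mul_pos (Real.exp_pos _) (h1 _), mul_le_of_le_one_right (Real.exp_pos _).le (h2 _)⟩
  · dsimp only
    split_ifs with hk
    · refine ⟨fun _ => ?_, fun hc => absurd (hstart u hu hk) hc⟩
      have h1 := hlt u U hu hk
      have h2 := spiralY_eventAngle_pos hn b U
      nlinarith
    · obtain ⟨hd1, hd2⟩ := Nat.find_spec (hex (visit hn b u))
      have hmin := fun w => Nat.find_min (hex (visit hn b u)) (m := w)
      generalize Nat.find (hex (visit hn b u)) = d at *
      rcases lt_or_ge u d with hud | hud
      · have hc : cross u := by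
          by_contra hc
          exact hmin u hud ⟨rfl, fun h => hc h.2⟩
        exact ⟨fun _ => hlt u d hud hd1.symm, fun h => absurd hc h⟩
      · have hdc : ¬ cross d := fun h => hd2 ⟨by omega, h⟩
        have hnc : ¬ cross u := by
          obtain ⟨j, hj⟩ : n ∣ u - d :=
            (Nat.modEq_iff_dvd' hud).mp ((visit_eq_visit_iff hn b d u).mp hd1)
          have hu' : u = d + n * j := by omega
          have : ∀ i, d + n * i < U → ¬ cross (d + n * i) := by
            intro i
            induction i with
            | zero => intro _; simpa using hdc
            | succ i ih =>
              intro hi hc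
              rw [mul_add, mul_one, ← add_assoc] at hi hc
              exact ih (by omega) (hdown _ hi hc)
          rw [hu']; exact this j (by omega)
        refine ⟨fun h => absurd h hnc, fun _ => ?_⟩
        have h2 := spiralY_eventAngle_pos hn b d
        have h3 : spiralY (eventAngle hn b u) ≤ spiralY (eventAngle hn b d) := by
          rcases hud.eq_or_lt with h | h
          · rw [h]
          · have h1 := hlt d u h hd1
            have h4 := spiralY_eventAngle_pos hn b u
            nlinarith
        nlinarith

lemma hasWord_map {γ : ℝ → ℝ × ℝ} {k₀ : Fin n} (h0 : γ 0 = markedPoint k₀) (T : List ℕ)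
    (hT : T.Pairwise (· > ·)) (time : ℕ → ℝ) (htime : StrictAnti time) (p : ℕ → Fin n)
    (h : ∀ (t : ℝ) (k : Fin n), (t ∈ Set.Ioc (0 : ℝ) 1 ∧ γ t ∈ ray k) ↔
      ∃ u ∈ T, time u = t ∧ p u = k) : HasWord γ k₀ (T.map p) := by
  refine ⟨h0, fun l => time (T[(l : ℕ)]'(by simpa using l.2)), fun i j hij => ?_, fun t k => ?_⟩
  · exact htime (List.pairwise_iff_getElem.mp hT i j (by simpa using i.2) (by simpa using j.2) hij)
  · rw [h]
    constructor
    · rintro ⟨u, hu, rfl, rfl⟩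
      obtain ⟨i, hi, rfl⟩ := List.mem_iff_getElem.mp hu
      exact ⟨⟨i, by simpa using hi⟩, rfl, by simp⟩
    · rintro ⟨l, rfl, rfl⟩
      exact ⟨_, List.getElem_mem _, rfl, by simp⟩

/-- The spiral curve which passes `U` events before its end and crosses the rays at prescribed
events. -/
theorem exists_spiral_curve (hn : 0 < n) (b : Bool) (U : ℕ) (cross : ℕ → Prop)
    [DecidablePred cross] (hstart : ∀ u < U, visit hn b u = visit hn b U → cross u)
    (hdown : ∀ u, u + n < U → cross (u + n) → cross u) :
    ∃ γ, IsAdmissible n γ ∧ NonSelfCrossing γ ∧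
      HasWord γ (visit hn b U)
        (((List.range' 0 U).reverse.filter fun u => cross u).map (visit hn b)) := by
  obtain ⟨y, hy, hyU, hcross⟩ := exists_heights hn b U cross hstart hdown
  -- Since `y k ≤ exp π`, this scale makes `κ * (y k + 1) ≤ 1`, so the values prescribed for `g` are
  -- nonnegative.
  set κ : ℝ := Real.exp (-Real.pi) / 2 with hκ
  have hκ0 : 0 < κ := by positivity
  have hval : ∀ k, 0 ≤ 1 - κ * (y k + 1) := by
    intro k
    have h1 : Real.exp (-Real.pi) * Real.exp Real.pi = 1 := by rw [← Real.exp_add]; simp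
    have h2 : Real.exp (-Real.pi) ≤ 1 := Real.exp_le_one_iff.mpr (by linarith [Real.pi_pos])
    have h3 := mul_le_mul_of_nonneg_left (hy k).2 (Real.exp_pos (-Real.pi)).le
    rw [hκ]
    linarith
  obtain ⟨g, hg, hg0, hgnn, hgk⟩ := exists_smooth_interpolation (fun k => 1 - κ * (y k + 1)) hval
  set Φ := eventAngle hn b U with hΦ
  have hΦ0 : 0 < Φ := eventAngle_pos hn b U
  -- The shear by `g` takes `(k + 1, y k)` to the marked point and the end `(0, -1)` of the spiral
  -- to the origin; heights at least `-1` and `0 ≤ g` keep the curve in the half-plane.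
  let F : ℝ → ℝ × ℝ := fun φ => (spiralX n b φ, κ * (spiralY φ + 1) + g (spiralX n b φ))
  have hF : ContDiff ℝ ∞ F := by
    have h1 := contDiff_spiralX (n := n) b
    exact h1.prodMk ((contDiff_const.mul (contDiff_spiralY.add contDiff_const)).add (hg.comp h1))
  let γ : ℝ → ℝ × ℝ := fun t => F ((1 - t) * Φ)
  have hγ : ContDiff ℝ ∞ γ := hF.comp (by fun_prop)
  have hFinj : Function.Injective F := by
    intro φ ψ h
    obtain ⟨h1, h2⟩ := Prod.mk.inj h
    rw [h1] at h2
    have h3 := mul_left_cancel₀ hκ0.ne' (add_right_cancel h2)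
    exact spiral_injective b h1 (add_right_cancel h3)
  have hγinj : Function.Injective γ := by
    intro s t h
    have h1 := mul_right_cancel₀ hΦ0.ne' (hFinj h)
    linarith
  have hγ1 : γ 1 = (0, 0) := by
    simp [γ, F, spiralX, spiralY, hg0]
  have hFX : ∀ u, (F (eventAngle hn b u)).1 = (visit hn b u : ℝ) + 1 := fun u =>
    (spiralX_eq_iff b _ _).mpr (sin_eventAngle hn b u)
  have hF2 : ∀ φ (k : Fin n), (F φ).1 = (k : ℝ) + 1 → (F φ).2 = 1 + κ * (spiralY φ - y k) := by
    intro φ k h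
    have h1 : g (spiralX n b φ) = 1 - κ * (y k + 1) := by rw [← hgk k]; exact congrArg g h
    simp only [F, h1]
    ring
  have hγ0 : γ 0 = markedPoint (visit hn b U) := by
    have h1 := hF2 Φ _ (hFX U)
    rw [hyU, sub_self, mul_zero, add_zero] at h1
    have h2 : γ 0 = F Φ := by simp [γ]
    rw [h2]
    exact Prod.ext (hFX U) h1
  -- As `y k` is positive, a ray can only be met on the upper half of a turn, hence at an event.
  have hray : ∀ φ, 0 ≤ φ → φ < Φ → ∀ k : Fin n, F φ ∈ ray k →
      ∃ u < U, φ = eventAngle hn b u ∧ visit hn b u = k ∧ cross u := by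
    rintro φ hφ0 hφ k ⟨hx, hz⟩
    rw [hF2 φ k hx] at hz
    have hle : y k ≤ spiralY φ := by
      by_contra hcon
      have := mul_neg_of_pos_of_neg hκ0 (sub_neg.mpr (not_le.mp hcon))
      linarith
    have hYpos := (hy k).1.trans_le hle
    have hcos : Real.cos φ < 0 := by
      by_contra hcon
      have := mul_nonneg (Real.exp_pos (-φ)).le (not_lt.mp hcon)
      rw [spiralY] at hYpos
      linarith
    obtain ⟨u, hu, rfl⟩ := exists_eventAngle_eq hn b hφ0 hcos ((spiralX_eq_iff b φ k).mp hx)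
    have huU : u < U := (strictMono_eventAngle hn b).lt_iff_lt.mp hφ
    refine ⟨u, huU, rfl, hu, ?_⟩
    by_contra hc
    have := (hcross u huU).2 hc
    rw [hu] at this
    linarith
  have hpar : ∀ t ∈ Set.Ioc (0 : ℝ) 1, 0 ≤ (1 - t) * Φ ∧ (1 - t) * Φ < Φ := by
    rintro t ⟨ht0, ht1⟩
    exact ⟨mul_nonneg (by linarith) hΦ0.le, by nlinarith⟩
  refine ⟨γ, ⟨hγ.contDiffOn, fun t ht => ?_, ⟨_, hγ0⟩, hγ1, fun t ht h => ?_, fun t ht k hk => ?_⟩,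
    hγinj.injOn, ?_⟩
  · have h1 := neg_one_le_spiralY (mul_nonneg (sub_nonneg.mpr ht.2) hΦ0.le)
    exact add_nonneg (mul_nonneg hκ0.le (by linarith)) (hgnn _)
  · rcases h with h | ⟨k, hk⟩
    · exact Or.inr (hγinj (h.trans hγ1.symm))
    · refine Or.inl (by_contra fun ht0 => ?_)
      have ht' : t ∈ Set.Ioc (0 : ℝ) 1 := ⟨lt_of_le_of_ne ht.1 (Ne.symm ht0), ht.2⟩
      obtain ⟨h1, h2⟩ := hpar t ht'
      have hmem : F ((1 - t) * Φ) ∈ ray k := by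
        change γ t ∈ ray k
        rw [hk]; exact ⟨rfl, le_rfl⟩
      obtain ⟨u, hu, he, hv, hc⟩ := hray _ h1 h2 k hmem
      have h3 := hF2 _ k hmem.1
      have h4 : (F ((1 - t) * Φ)).2 = 1 := congrArg Prod.snd hk
      have h5 := (hcross u hu).1 hc
      rw [hv, ← he] at h5
      have := mul_pos hκ0 (sub_pos.mpr h5)
      linarith
  · obtain ⟨h1, h2⟩ := hpar t ht
    obtain ⟨u, hu, he, hv, hc⟩ := hray _ h1 h2 k hk
    have htIcc : t ∈ Set.Icc (0 : ℝ) 1 := ⟨ht.1.le, ht.2⟩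
    have hd : HasDerivAt γ (deriv γ t) t := (hγ.differentiable (by simp) t).hasDerivAt
    rw [hd.differentiableAt.derivWithin (uniqueDiffOn_Icc zero_lt_one t htIcc)]
    have hXd : HasDerivAt (spiralX n b) (deriv (spiralX n b) ((1 - t) * Φ)) ((1 - t) * Φ) :=
      ((contDiff_spiralX b).differentiable (by simp) _).hasDerivAt
    have hlin : HasDerivAt (fun s : ℝ => (1 - s) * Φ) (-1 * Φ) t :=
      ((hasDerivAt_id t).const_sub 1).mul_const Φ
    have h3 : HasDerivAt (fun s => (γ s).1) (deriv γ t).1 t := by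
      simpa using hd.hasFDerivAt.fst.hasDerivAt
    have hcomp : HasDerivAt (fun s => (γ s).1)
        (deriv (spiralX n b) ((1 - t) * Φ) * (-1 * Φ)) t :=
      HasDerivAt.comp (h₂ := spiralX n b) t hXd hlin
    rw [h3.unique hcomp]
    refine mul_ne_zero (deriv_spiralX_ne_zero b hk.1 ?_) (by linarith)
    rw [he]
    exact spiralY_eventAngle_pos hn b u
  · refine hasWord_map hγ0 _ ?_ (fun u => 1 - eventAngle hn b u / Φ) ?_ _ fun t k => ?_
    · apply List.Pairwise.filter
      rw [List.pairwise_reverse]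
      exact List.pairwise_lt_range'
    · intro u w huw
      have := div_lt_div_of_pos_right (strictMono_eventAngle hn b huw) hΦ0
      simp only
      linarith
    · constructor
      · rintro ⟨ht, hk⟩
        obtain ⟨h1, h2⟩ := hpar t ht
        obtain ⟨u, hu, he, hv, hc⟩ := hray _ h1 h2 k hk
        refine ⟨u, by simp [hu, hc], ?_, hv⟩
        rw [← he, mul_div_assoc, div_self hΦ0.ne']
        ring
      · rintro ⟨u, hu, rfl, rfl⟩
        simp only [List.mem_filter, List.mem_reverse, List.mem_range'_1, decide_eq_true_eq] at hu
        have huU : u < U := by omega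
        have h1 : eventAngle hn b u < Φ := strictMono_eventAngle hn b huU
        have h2 := eventAngle_pos hn b u
        have h3 : γ (1 - eventAngle hn b u / Φ) = F (eventAngle hn b u) := by
          simp only [γ]
          congr 1
          field_simp
          ring
        refine ⟨⟨?_, ?_⟩, ?_⟩
        · have := (div_lt_one hΦ0).mpr h1
          linarith
        · have := div_pos h2 hΦ0
          linarith
        · rw [h3]
          refine ⟨hFX u, ?_⟩
          rw [hF2 _ _ (hFX u)]
          have := mul_pos hκ0 (sub_pos.mpr ((hcross u huU).1 hu.2))
          linarith

end SpiralCurve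

/-! ### Roots, words and the choice of the orientation. -/

section Roots

variable {n : ℕ} {Q : Quiver.{v} (Fin n)}

lemma simpleReflection_neg (i : Fin n) (β : Fin n → ℤ) :
    simpleReflection Q i (-β) = -simpleReflection Q i β := by
  have : ∑ j, cartanMatrix Q i j * (-β) j = -∑ j, cartanMatrix Q i j * β j := by
    simp
  rw [simpleReflection, this, simpleReflection, neg_smul]
  abel

lemma IsRoot.neg {β : Fin n → ℤ} (h : IsRoot Q β) : IsRoot Q (-β) := by
  induction h with
  | simple i =>
    have : -simpleRoot i = simpleReflection Q i (simpleRoot i) := by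
      have h : ∑ j, cartanMatrix Q i j * simpleRoot i j = 2 :=
        (mulVec_simpleRoot (cartanMatrix Q) i i).trans (by simp [cartanMatrix])
      rw [simpleReflection, h, two_smul]
      abel
    rw [this]
    exact .reflect i _ (.simple i)
  | reflect i β _ ih =>
    rw [← simpleReflection_neg]
    exact .reflect i _ ih

lemma isRoot_wordRoot (π : Equiv.Perm (Fin n)) (k₀ : Fin n) (ks : List (Fin n)) :
    IsRoot Q (wordRoot Q π k₀ ks) := by
  induction ks using List.reverseRecOn with
  | nil => exact .simple _
  | append_singleton ks k ih =>
    rw [wordRoot, List.foldl_append]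
    exact .reflect _ _ ih

lemma IsRoot.cartanNorm_eq (hC : IsSweepable (cartanMatrix Q)) {β : Fin n → ℤ}
    (h : IsRoot Q β) : cartanNorm (cartanMatrix Q) β = 2 := by
  induction h with
  | simple i => exact cartanNorm_simpleRoot hC.diag i
  | reflect i β _ ih => exact (cartanNorm_reflection hC.symm hC.diag β i).trans ih

/-- Reading a sweep backwards gives a non-decreasing word. -/
lemma wordRoot_sweep (hd : ∀ i, cartanMatrix Q i i = 2) (π : Equiv.Perm (Fin n)) (p : ℕ → Fin n)
    (β : Fin n → ℤ) {U : ℕ}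
    (hU : sweep (cartanMatrix Q) (fun u => π (p u)) β U = simpleRoot (π (p U)))
    (hle : ∀ u < U, sweep (cartanMatrix Q) (fun u => π (p u)) β (u + 1) ≤
      sweep (cartanMatrix Q) (fun u => π (p u)) β u) (d : ℕ) :
    ∀ w, w + d = U → ∀ ks, ks = (((List.range' w d).reverse.filter fun u =>
        sweep (cartanMatrix Q) (fun u => π (p u)) β u (π (p u)) ≠ 0).map p) →
      wordRoot Q π (p U) ks = sweep (cartanMatrix Q) (fun u => π (p u)) β w ∧
      ∀ i < ks.length, wordRoot Q π (p U) (ks.take i) ≤ wordRoot Q π (p U) (ks.take (i + 1)) := by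
  induction d with
  | zero =>
    rintro w rfl ks rfl
    exact ⟨hU.symm, by simp⟩
  | succ d ih =>
    rintro w hw ks rfl
    obtain ⟨h1, h2⟩ := ih (w + 1) (by omega) _ rfl
    rw [List.range'_succ, List.reverse_cons, List.filter_append, List.map_append]
    generalize ((List.range' (w + 1) d).reverse.filter fun u =>
        sweep (cartanMatrix Q) (fun u => π (p u)) β u (π (p u)) ≠ 0).map p = ks at *
    have hs := hle w (by omega)
    by_cases hc : sweep (cartanMatrix Q) (fun u => π (p u)) β w (π (p w)) = 0
    · have : sweep (cartanMatrix Q) (fun u => π (p u)) β (w + 1) =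
          sweep (cartanMatrix Q) (fun u => π (p u)) β w := if_pos hc
      rw [this] at h1
      simpa [hc] using ⟨h1, h2⟩
    · have hstep : sweep (cartanMatrix Q) (fun u => π (p u)) β (w + 1) =
          reflection (cartanMatrix Q) (π (p w))
            (sweep (cartanMatrix Q) (fun u => π (p u)) β w) := if_neg hc
      have hlast : wordRoot Q π (p U) (ks ++ [p w]) =
          sweep (cartanMatrix Q) (fun u => π (p u)) β w := by
        rw [wordRoot, List.foldl_append]
        change reflection (cartanMatrix Q) (π (p w)) (wordRoot Q π (p U) ks) = _
        rw [h1, hstep, reflection_reflection hd]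
      have hsing : ([w].filter fun u =>
          sweep (cartanMatrix Q) (fun u => π (p u)) β u (π (p u)) ≠ 0).map p = [p w] := by
        simp [hc]
      rw [hsing]
      refine ⟨hlast, fun i hi => ?_⟩
      rw [List.length_append, List.length_singleton] at hi
      rcases (by omega : i < ks.length ∨ i = ks.length) with hi' | rfl
      · rw [List.take_append_of_le_length hi'.le, List.take_append_of_le_length hi']
        exact h2 i hi'
      · rw [List.take_append_of_le_length le_rfl, List.take_length,
          List.take_of_length_le (by simp), h1, hlast]
        exact hs

/-- In one of the two directions, the descent next to the ascent of a root is met first. -/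
lemma exists_descentFirst (hn : 0 < n) {C : Matrix (Fin n) (Fin n) ℤ} (hC : IsSweepable C)
    (π : Equiv.Perm (Fin n)) {β : Fin n → ℤ} (h0 : 0 ≤ β) (hN : cartanNorm C β = 2) :
    ∃ b, DescentFirst C (fun u => π (visit hn b u)) β 0 := by
  by_cases hex : ∃ v, IsAscent C β v
  · obtain ⟨v, hv⟩ := hex
    obtain ⟨w, hw, hw1⟩ := hC.exists_descent β h0 hN v hv
    have hne : π.symm v ≠ π.symm w := by
      intro h
      rw [π.symm.injective h, hC.diag] at hw
      omega
    suffices h : ∃ b x, π (visit hn b x) = w ∧ ∀ y ≤ x, π (visit hn b y) ≠ v by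
      obtain ⟨b, x, hx, hy⟩ := h
      refine ⟨b, fun v' hv' => ?_⟩
      obtain rfl := hC.ascent_unique β h0 hN v v' hv hv'
      exact ⟨w, hw, hw1, x, Nat.zero_le x, hx, fun y _ => hy y⟩
    have hw2 := (π.symm w).2
    -- The first round runs downwards for `true` and upwards for `false`; the orientation is the one
    -- that meets `w` before `v`.
    rcases lt_or_gt_of_ne hne with h | h
    · have h' : (π.symm v : ℕ) < π.symm w := h
      refine ⟨true, n - 1 - π.symm w, ?_, fun y hy hyv => ?_⟩
      · rw [← π.apply_symm_apply w, π.apply_eq_iff_eq, π.apply_symm_apply]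
        ext
        simp [visit, Nat.mod_eq_of_lt (show n - 1 - (π.symm w : ℕ) < n by omega)]
        omega
      · have h1 := congrArg Fin.val (π.eq_symm_apply.mpr hyv)
        simp [visit, Nat.mod_eq_of_lt (show y < n by omega)] at h1
        omega
    · have h' : (π.symm w : ℕ) < π.symm v := h
      refine ⟨false, π.symm w, ?_, fun y hy hyv => ?_⟩
      · rw [← π.apply_symm_apply w, π.apply_eq_iff_eq, π.apply_symm_apply]
        ext
        simp [visit, Nat.mod_eq_of_lt hw2]
      · have h1 := congrArg Fin.val (π.eq_symm_apply.mpr hyv)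
        simp [visit, Nat.mod_eq_of_lt (show y < n by omega)] at h1
        omega
  · push Not at hex
    exact ⟨true, fun v hv => absurd hv (hex v)⟩

end Roots

end AdmissibleCurve

theorem proposition5p3 {n : ℕ} (Q : Quiver.{v} (Fin n))
    (hQ : AdmissibleCurve.IsTypeA Q ∨ AdmissibleCurve.IsTypeD Q)
    (π : Equiv.Perm (Fin n)) (hπ : π ∈ AdmissibleCurve.permSet Q) :
    AdmissibleCurve.nonDecreasingRoots Q π = AdmissibleCurve.positiveRoots Q := by
  open AdmissibleCurve in
  have hn : 0 < n := by
    rcases hQ with h | h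
    · exact h.1
    · exact lt_of_lt_of_le (by norm_num) h.1
  have hC := isSweepable_cartanMatrix hQ
  ext β
  constructor
  · rintro ⟨γ, -, -, -, k₀, ks, -, ⟨h0, rfl⟩ | ⟨h0, rfl⟩⟩
    · exact ⟨isRoot_wordRoot π k₀ ks, h0⟩
    · exact ⟨(isRoot_wordRoot π k₀ ks).neg, neg_nonneg.mpr h0⟩
  · rintro ⟨hβ, h0⟩
    have hN := hβ.cartanNorm_eq hC
    obtain ⟨b, hb⟩ := exists_descentFirst hn hC π h0 hN
    obtain ⟨U, hU, hstep⟩ :=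
      hC.exists_sweep_eq_simpleRoot (isCyclic_visit hn b π) h0 hN hb
    have hnn : ∀ u ≤ U, 0 ≤ sweep (cartanMatrix Q) (fun u => π (visit hn b u)) β u := by
      intro u hu
      cases u with
      | zero => exact h0
      | succ u => exact (hstep u hu).1
    have hanti : ∀ u w, u ≤ w → w ≤ U →
        sweep (cartanMatrix Q) (fun u => π (visit hn b u)) β w ≤
          sweep (cartanMatrix Q) (fun u => π (visit hn b u)) β u := by
      intro u w huw
      induction w, huw using Nat.le_induction with
      | base => exact fun _ => le_rfl
      | succ w _ ih => exact fun hw => (hstep w hw).2.trans (ih (by omega))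
    obtain ⟨γ, hγ, hγ', hword⟩ := exists_spiral_curve hn b U
      (fun u => sweep (cartanMatrix Q) (fun u => π (visit hn b u)) β u (π (visit hn b u)) ≠ 0)
      -- The coefficient at the final vertex ends at `1`, so it is never `0` before.
      (fun u hu hv h => by
        have h1 := hanti u U hu.le le_rfl (π (visit hn b U))
        rw [hU, ← hv, h] at h1
        simp [simpleRoot] at h1)
      -- A nonnegative, non-increasing coefficient that is `0` at `u` is still `0` one round later.
      (fun u hu hc h => by
        rw [visit_add] at hc
        have h1 := hanti u (u + n) (by omega) hu.le (π (visit hn b u))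
        have h2 := hnn (u + n) hu.le (π (visit hn b u))
        rw [h] at h1
        exact hc (le_antisymm h1 h2))
    obtain ⟨h1, h2⟩ := wordRoot_sweep hC.diag π (visit hn b) β hU (fun u hu => (hstep u hu).2) U 0
      (by omega) _ rfl
    have h3 : wordRoot Q π (visit hn b U) _ = β := h1
    exact ⟨γ, hγ, hγ', ⟨_, _, hword, h2⟩, ⟨_, _, hword, Or.inl ⟨by rw [h3]; exact h0, h3.symm⟩⟩⟩
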